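/- **Setting.** For complex matrices write $X^{\#}$ for the entrywise complex conjugate, $X^\dagger$ for the adjoint, $\Delta(X,Y)=\left(\begin{smallmatrix}X&Y\\Y^{\#}&X^{\#}\end{smallmatrix}\right)$ (a "doubled-up" matrix), $J_n=\mathrm{diag}(1_n,-1_n)$, and $Z^\flat=J_nZ^\dagger J_k$ for $Z\in\mathbb C^{2k\times 2n}$. A matrix $T\in\mathbb C^{2n\times 2n}$ is *symplectic* if $T^\flat T=TT^\flat=1$ and $T$ is doubled-up. A *quantum linear system* (QLS) with $n$ modes and $m$ channels is a triple $(S,C,\Omega)$ with $S=\Delta(S_-,S_+)\in\mathbb C^{2m\times 2m}$ symplectic (field scattering and squeezing), $C=\Delta(C_-,C_+)\in\mathbb C^{2m\times 2n}$, and $\Omega=\Delta(\Omega_-,\Omega_+)\in\mathbb C^{2n\times 2n}$, where $\Omega_-=\Omega_-^\dagger$ and $\Omega_+=\Omega_+^T$. Its system matrix is $A=-\tfrac12C^\flat C-iJ_n\Omega$ (the triple is also written $(S,C,A)$), its transfer function is $\Xi(s)=\bigl(1-C(s-A)^{-1}C^\flat\bigr)S$, and its power spectrum for the vacuum input $V_{\mathrm{vac}}=\mathrm{diag}(1_m,0_m)$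 is $\Psi(s)=\Xi(s)V_{\mathrm{vac}}\,\Xi(-\overline s)^\dagger$. Equalities of transfer functions or power spectra are meant for all $s\in\mathbb C$ at which both sides are defined (that is, off the eigenvalues of the system matrices). The system is *stable* if all eigenvalues of $A$ have negative real part, and *globally minimal* (for input $V_{\mathrm{vac}}$) if no stable QLS with the same channels and fewer modes has the same power spectrum. **Theorem.** Let $(S_1,C_1,\Omega_1)$ and $(S_2,C_2,\Omega_2)$ be stable, globally minimal QLSs with $m$ channels and with $n_1$ and $n_2$ modes. Let $A_i$, $\Xi_i$, $\Psi_i$ be their system matrices, transfer functions and power spectra. 1. $\Psi_1=\Psi_2$ if and only if $S_1V_{\mathrm{vac}}S_1^\dagger=S_2V_{\mathrm{vac}}S_2^\dagger$, $n_1=n_2$, and there is a symplectic matrix $T$ with $$C_1=C_2T^\flat,\qquad J_{n_1}\Omega_1=T\,J_{n_2}\Omega_2\,T^\flat .$$ 2. $\Psi_1=\Psi_2$ if and only if there is a unitary and symplectic matrix $U\in\mathbb C^{2m\times 2m}$ with $\Xi_1(s)=\Xi_2(s)U$ for all $s$. 3. Suppose that $S_1=1$. Then $\Psi_1=\Psi_2$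 if and only if $(S_2,C_2,A_2)=(U,\;C_1T^\flat,\;TA_1T^\flat)$ for some symplectic $T$ (so that $n_1=n_2$) and some unitary and symplectic $U$. Conversely, for all such $T\in\mathbb C^{2n_1\times 2n_1}$ and $U\in\mathbb C^{2m\times 2m}$ the triple $(U,\,C_1T^\flat,\,TA_1T^\flat)$ is a stable, globally minimal QLS that has the power spectrum $\Psi_1$ and the transfer function $\Xi_1(s)U$. -/

import Mathlib

open scoped Matrix ComplexConjugate

noncomputable section

namespace QuantumLinear

/-- The index set of doubled-up vectors of `n` modes (or `n` channels): the `n` annihilation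
components followed by the `n` creation components. -/
abbrev Dbl (n : ℕ) : Type := Fin n ⊕ Fin n

/-- The doubled-up matrix `Δ(X, Y)`, with block rows `(X, Y)` and `(Y^#, X^#)`, where `#` is the
entrywise complex conjugate. -/
def Delta {k n : ℕ} (X Y : Matrix (Fin k) (Fin n) ℂ) : Matrix (Dbl k) (Dbl n) ℂ :=
  Matrix.fromBlocks X Y (Y.map (starRingEnd ℂ)) (X.map (starRingEnd ℂ))

/-- The matrix `J_n = diag(1_n, -1_n)`. -/
def J (n : ℕ) : Matrix (Dbl n) (Dbl n) ℂ := Matrix.fromBlocks 1 0 0 (-1)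

/-- The covariance matrix `V_vac = diag(1_m, 0_m)` of the vacuum input. -/
def Vvac (m : ℕ) : Matrix (Dbl m) (Dbl m) ℂ := Matrix.fromBlocks 1 0 0 0

/-- The symplectic adjoint `Z^♭ = J Z^† J`. -/
def flat {k n : ℕ} (Z : Matrix (Dbl k) (Dbl n) ℂ) : Matrix (Dbl n) (Dbl k) ℂ :=
  J n * Zᴴ * J k

/-- `T` is symplectic: it is `♭`-unitary and of doubled-up form. The two `♭`-unitarity equations
can hold only if `k = n`; allowing `k` and `n` to differ as variables spares a cast between
systems whose numbers of modes are only later seen to agree. -/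
def IsSymplectic {k n : ℕ} (T : Matrix (Dbl k) (Dbl n) ℂ) : Prop :=
  flat T * T = 1 ∧ T * flat T = 1 ∧ ∃ X Y : Matrix (Fin k) (Fin n) ℂ, T = Delta X Y

/-- `U` is a passive field transformation: symplectic and unitary. -/
def IsPassive {m : ℕ} (U : Matrix (Dbl m) (Dbl m) ℂ) : Prop :=
  IsSymplectic U ∧ U ∈ Matrix.unitaryGroup (Dbl m) ℂ

/-- A quantum linear system with `n` modes and `m` channels: a static scattering and squeezing of
the field, the coupling of the modes to the field, and the quadratic Hamiltonian of the modes. -/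
structure QLS (n m : ℕ) where
  Sminus : Matrix (Fin m) (Fin m) ℂ
  Splus : Matrix (Fin m) (Fin m) ℂ
  Cminus : Matrix (Fin m) (Fin n) ℂ
  Cplus : Matrix (Fin m) (Fin n) ℂ
  OmegaMinus : Matrix (Fin n) (Fin n) ℂ
  OmegaPlus : Matrix (Fin n) (Fin n) ℂ
  symplectic_S : IsSymplectic (Delta Sminus Splus)
  hermitian_OmegaMinus : OmegaMinusᴴ = OmegaMinus
  symmetric_OmegaPlus : OmegaPlusᵀ = OmegaPlus

namespace QLS

variable {n m : ℕ}

/-- The scattering and squeezing matrix `S = Δ(S₋, S₊)`. -/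
def S (G : QLS n m) : Matrix (Dbl m) (Dbl m) ℂ := Delta G.Sminus G.Splus

/-- The coupling matrix `C = Δ(C₋, C₊)`. -/
def C (G : QLS n m) : Matrix (Dbl m) (Dbl n) ℂ := Delta G.Cminus G.Cplus

/-- The Hamiltonian matrix `Ω = Δ(Ω₋, Ω₊)`. -/
def Omega (G : QLS n m) : Matrix (Dbl n) (Dbl n) ℂ := Delta G.OmegaMinus G.OmegaPlus

/-- The system matrix `A = -(1/2) C^♭ C - i J Ω`. -/
def A (G : QLS n m) : Matrix (Dbl n) (Dbl n) ℂ :=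
  -((1 / 2 : ℂ) • (flat G.C * G.C)) - Complex.I • (J n * G.Omega)

/-- Hurwitz stability: all eigenvalues of `A` lie in the open left half plane. -/
def IsStable (G : QLS n m) : Prop := ∀ z ∈ spectrum ℂ G.A, z.re < 0

/-- The transfer function `Ξ(s) = (1 - C (s - A)⁻¹ C^♭) S`; meaningful for `s` outside the
spectrum of `A`. -/
def transferFunction (G : QLS n m) (s : ℂ) : Matrix (Dbl m) (Dbl m) ℂ :=
  (1 - G.C * (s • (1 : Matrix (Dbl n) (Dbl n) ℂ) - G.A)⁻¹ * flat G.C) * G.S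

/-- The power spectrum `Ψ(s) = Ξ(s) V_vac Ξ(-s̄)^†` for vacuum input; meaningful if neither `s`
nor `-s̄` is an eigenvalue of `A`. -/
def powerSpectrum (G : QLS n m) (s : ℂ) : Matrix (Dbl m) (Dbl m) ℂ :=
  G.transferFunction s * Vvac m * (G.transferFunction (-(conj s)))ᴴ

/-- The power spectra of two systems agree at every `s` at which both are defined. -/
def SamePowerSpectrum {n₁ n₂ m : ℕ} (G₁ : QLS n₁ m) (G₂ : QLS n₂ m) : Prop :=
  ∀ s : ℂ, s ∉ spectrum ℂ G₁.A → s ∉ spectrum ℂ G₂.A →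
    -(conj s) ∉ spectrum ℂ G₁.A → -(conj s) ∉ spectrum ℂ G₂.A →
    G₁.powerSpectrum s = G₂.powerSpectrum s

/-- `Ξ₁(s) = Ξ₂(s) U` at every `s` at which both transfer functions are defined. -/
def TransferEqMul {n₁ n₂ m : ℕ} (G₁ : QLS n₁ m) (G₂ : QLS n₂ m)
    (U : Matrix (Dbl m) (Dbl m) ℂ) : Prop :=
  ∀ s : ℂ, s ∉ spectrum ℂ G₁.A → s ∉ spectrum ℂ G₂.A →
    G₁.transferFunction s = G₂.transferFunction s * U

/-- Global minimality for vacuum input: no stable system with fewer modes (and the same channels)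
has the same power spectrum. -/
def IsGloballyMinimal (G : QLS n m) : Prop :=
  ∀ k : ℕ, k < n → ∀ G' : QLS k m, G'.IsStable → ¬ SamePowerSpectrum G' G

end QLS

end QuantumLinear

end

open QuantumLinear

/-! Let P = Q + J/2 be the stationary covariance of the modes, N = S V_vac S^† and K = P C^† − C^♭
N. The Lyapunov equation for P splits the power spectrum into N + C(s−A)⁻¹K plus the para-adjoint of
its dynamic part (`powerSpectrum_eq`). The poles of the two parts lie in opposite half planes, so Ψ
determines N and all Markov parameters C A^j K (`separation`, `SamePowerSpectrum.markov`). The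
nonlinear problem for Ψ thus becomes a linear realization problem for (A, K, C).

Observability of (A, C) comes free from stability, because A + A^♭ = −C^♭C. Controllability of (A,
K) is where global minimality enters. A failure gives x ≠ 0 with A^†x = zx and K^†x = 0. Then r =
JQx has the same properties and JQr = x/4, so JQ has an eigenvector with eigenvalue ±1/2 in the span
of x and r. Its form x^†Jx is nonzero, so it and its conjugate span a genuine mode. Compressing to
the symplectic complement of this mode preserves Ψ and stability, against minimality
(`exists_smaller`, `exists_reduction`).

The state space isomorphism theorem (`exists_similarity`) now yields an invertible intertwiner T. It
is doubled-up because its conjugate also intertwines and observability makes intertwiners unique. It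
is symplectic because T^♭T and 1 solve the same Sylvester equation (`isSymplectic_of_similarity`).
Equality of the matrices N is equality of S S^†, so the scattering matrices differ by a passive
factor on the right (`exists_passive`). Such a factor fixes V_vac, which gives the converse
directions. -/

namespace QuantumLinear

open Polynomial

set_option linter.unusedSectionVars false

/-! ### Sylvester equations, rational matrix functions and realization theory. -/

section LinearAlgebra

variable {ι κ μ ν : Type*} [Fintype ι] [DecidableEq ι] [Fintype κ] [DecidableEq κ]
  [Fintype μ] [DecidableEq μ] [Fintype ν] [DecidableEq ν]

/-- An endomorphism has an eigenvector in every nonzero invariant subspace. -/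
theorem exists_eigenvector_mem {V : Type*} [AddCommGroup V] [Module ℂ V] [FiniteDimensional ℂ V]
    (f : Module.End ℂ V) (p : Submodule ℂ V) (hp : ∀ x ∈ p, f x ∈ p) (hne : p ≠ ⊥) :
    ∃ z : ℂ, ∃ x ∈ p, x ≠ 0 ∧ f x = z • x := by
  have : Nontrivial p := Submodule.nontrivial_iff_ne_bot.2 hne
  obtain ⟨z, hz⟩ := Module.End.exists_eigenvalue (f.restrict hp)
  obtain ⟨x, hx⟩ := hz.exists_hasEigenvector
  refine ⟨z, x, x.2, fun h => hx.2 (Subtype.ext h), ?_⟩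
  have := congrArg Subtype.val hx.apply_eq_smul
  simpa using this

theorem mem_spectrum_of_mulVec {A : Matrix ι ι ℂ} {z : ℂ} {x : ι → ℂ} (hx : x ≠ 0)
    (h : A *ᵥ x = z • x) : z ∈ spectrum ℂ A := by
  rw [← Matrix.spectrum_toLin', ← Module.End.hasEigenvalue_iff_mem_spectrum]
  exact Module.End.hasEigenvalue_of_hasEigenvector
    (Module.End.hasEigenvector_iff.2 ⟨Module.End.mem_eigenspace_iff.2 (by simpa using h), hx⟩)

theorem exists_mulVec_of_mem_spectrum {A : Matrix ι ι ℂ} {z : ℂ} (hz : z ∈ spectrum ℂ A) :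
    ∃ x ≠ 0, A *ᵥ x = z • x := by
  rw [← Matrix.spectrum_toLin', ← Module.End.hasEigenvalue_iff_mem_spectrum] at hz
  obtain ⟨x, hx⟩ := hz.exists_hasEigenvector
  exact ⟨x, hx.2, by simpa using hx.apply_eq_smul⟩

theorem mem_spectrum_of_mul_eq_smul {A : Matrix ι ι ℂ} {z : ℂ} {X : Matrix ι κ ℂ} (hX : X ≠ 0)
    (h : A * X = z • X) : z ∈ spectrum ℂ A := by
  obtain ⟨j, hj⟩ : ∃ j, X.col j ≠ 0 := by
    by_contra! h0
    exact hX (by ext i j; simpa using congrFun (h0 j) i)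
  refine mem_spectrum_of_mulVec hj ?_
  ext i
  have := congrFun (congrFun h i) j
  simpa [Matrix.mul_apply, Matrix.mulVec, dotProduct] using this

theorem mem_spectrum_transpose {A : Matrix ι ι ℂ} {z : ℂ} :
    z ∈ spectrum ℂ Aᵀ ↔ z ∈ spectrum ℂ A := by
  simp [Matrix.mem_spectrum_iff_isRoot_charpoly, Matrix.charpoly_transpose]

theorem mem_spectrum_conjTranspose {A : Matrix ι ι ℂ} {z : ℂ} :
    z ∈ spectrum ℂ Aᴴ ↔ conj z ∈ spectrum ℂ A := by
  rw [← Matrix.star_eq_conjTranspose, spectrum.map_star, Set.mem_star]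
  rfl

/-- All eigenvalues lie in the open left half plane. -/
def IsHurwitz (A : Matrix ι ι ℂ) : Prop := ∀ z ∈ spectrum ℂ A, z.re < 0

theorem IsHurwitz.conjTranspose {A : Matrix ι ι ℂ} (h : IsHurwitz A) : IsHurwitz Aᴴ := by
  intro z hz
  simpa using h _ (mem_spectrum_conjTranspose.1 hz)

/-- The Sylvester equation of two Hurwitz matrices has only the trivial homogeneous solution. -/
theorem eq_zero_of_sylvester {A : Matrix ι ι ℂ} {B : Matrix κ κ ℂ} (hA : IsHurwitz A)
    (hB : IsHurwitz B) {X : Matrix ι κ ℂ} (hX : A * X + X * B = 0) : X = 0 := by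
  by_contra hne
  let f : Module.End ℂ (Matrix ι κ ℂ) :=
    { toFun := fun X => A * X
      map_add' := fun X Y => Matrix.mul_add _ _ _
      map_smul' := fun c X => by simp }
  -- Left multiplication by A preserves the solution space. An eigenvector Y there satisfies A Y =
  -- zY and Y B = −zY, so both z and −z would have negative real part.
  let p : Submodule ℂ (Matrix ι κ ℂ) :=
    { carrier := {X | A * X + X * B = 0}
      add_mem' := fun {X Y} hX hY => by
        have : A * (X + Y) + (X + Y) * B = (A * X + X * B) + (A * Y + Y * B) := by
          rw [Matrix.mul_add, Matrix.add_mul]; abel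
        simp only [Set.mem_ofPred_eq] at *
        rw [this, hX, hY, add_zero]
      zero_mem' := by simp
      smul_mem' := fun c X hX => by
        simp only [Set.mem_ofPred_eq] at *
        rw [Matrix.mul_smul, Matrix.smul_mul, ← smul_add, hX, smul_zero] }
  obtain ⟨z, Y, hY, hY0, hYz⟩ := exists_eigenvector_mem f p
    (fun Y (hY : A * Y + Y * B = 0) => by
      change A * (A * Y) + (A * Y) * B = 0
      rw [Matrix.mul_assoc, ← Matrix.mul_add, hY, Matrix.mul_zero])
    (fun hbot => hne ((Submodule.eq_bot_iff p).1 hbot X hX))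
  have h1 := hA z (mem_spectrum_of_mul_eq_smul hY0 hYz)
  have hYB : Bᵀ * Yᵀ = (-z) • Yᵀ := by
    have h2 : A * Y + Y * B = 0 := hY
    have h3 : A * Y = z • Y := hYz
    rw [h3, add_comm, add_eq_zero_iff_eq_neg] at h2
    rw [← Matrix.transpose_mul, h2]; simp
  have h2 := hB (-z) (mem_spectrum_transpose.1
    (mem_spectrum_of_mul_eq_smul (by simpa using hY0) hYB))
  simp at h2
  linarith

/-- The Lyapunov equation of a Hurwitz matrix is solvable. -/
theorem exists_lyapunov {A : Matrix ι ι ℂ} (hA : IsHurwitz A) (N : Matrix ι ι ℂ) :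
    ∃ Q : Matrix ι ι ℂ, A * Q + Q * Aᴴ + N = 0 := by
  let f : Module.End ℂ (Matrix ι ι ℂ) :=
    { toFun := fun X => A * X + X * Aᴴ
      map_add' := fun X Y => by rw [Matrix.mul_add, Matrix.add_mul]; abel
      map_smul' := fun c X => by simp }
  have hf : Function.Injective f := (injective_iff_map_eq_zero f).2 fun X hX =>
    eq_zero_of_sylvester hA hA.conjTranspose hX
  obtain ⟨Q, hQ⟩ := (LinearMap.injective_iff_surjective.1 hf) (-N)
  exact ⟨Q, by rw [show A * Q + Q * Aᴴ = -N from hQ, neg_add_cancel]⟩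

theorem isUnit_smul_one_sub {A : Matrix ι ι ℂ} {s : ℂ} (h : s ∉ spectrum ℂ A) :
    IsUnit (s • (1 : Matrix ι ι ℂ) - A).det := by
  rw [← Matrix.isUnit_iff_isUnit_det]
  rw [spectrum.notMem_iff, Algebra.algebraMap_eq_smul_one] at h
  exact h

open Filter Bornology in
theorem tendsto_entry_resolvent (A : Matrix ι ι ℂ) (C : Matrix μ ι ℂ) (K : Matrix ι ν ℂ)
    (i : μ) (j : ν) :
    Tendsto (fun s : ℂ => (C * (s • (1 : Matrix ι ι ℂ) - A)⁻¹ * K) i j) (cobounded ℂ)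
      (nhds 0) := by
  let _ : NormedRing (Matrix ι ι ℂ) := Matrix.linftyOpNormedRing
  let _ : NormedAlgebra ℂ (Matrix ι ι ℂ) := Matrix.linftyOpNormedAlgebra
  have h := spectrum.resolvent_tendsto_cobounded (𝕜 := ℂ) A
  have h2 : Continuous fun X : Matrix ι ι ℂ => (C * X * K) i j := by fun_prop
  have h3 := (h2.tendsto 0).comp h
  simp only [Matrix.mul_zero, Matrix.zero_mul, Matrix.zero_apply] at h3
  refine h3.congr fun s => ?_
  simp only [Function.comp_apply, resolvent, Algebra.algebraMap_eq_smul_one,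
    Matrix.nonsing_inv_eq_ringInverse]

open Filter Bornology in
/-- A proper rational matrix function that vanishes near infinity has vanishing Markov
parameters. -/
theorem markov_eq_zero {A : Matrix ι ι ℂ} {K : Matrix ι ν ℂ} (j : ℕ) :
    ∀ {C : Matrix μ ι ℂ} {D : Matrix μ ν ℂ},
    (∀ᶠ s in cobounded ℂ, D + C * (s • (1 : Matrix ι ι ℂ) - A)⁻¹ * K = 0) →
    D = 0 ∧ C * A ^ j * K = 0 := by
  have key : ∀ {C : Matrix μ ι ℂ} {D : Matrix μ ν ℂ},
      (∀ᶠ s in cobounded ℂ, D + C * (s • (1 : Matrix ι ι ℂ) - A)⁻¹ * K = 0) →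
      D = 0 := by
    intro C D h
    ext i k
    have h1 := (tendsto_entry_resolvent A C K i k).const_add (D i k)
    have h2 : Tendsto (fun s : ℂ => D i k + (C * (s • (1 : Matrix ι ι ℂ) - A)⁻¹ * K) i k)
        (cobounded ℂ) (nhds 0) :=
      tendsto_const_nhds.congr' (h.mono fun s hs => by
        simpa using (congrFun (congrFun hs i) k).symm)
    simpa using tendsto_nhds_unique h1 h2
  have hspec : ∀ᶠ s in cobounded ℂ, s ∉ spectrum ℂ A :=
    (Matrix.finite_spectrum A).isBounded
  -- Once D = 0, multiplying by s returns an identity of the same shape with C A for C and C K for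
  -- D. The induction on j therefore keeps C and D general.
  have step : ∀ {C : Matrix μ ι ℂ} {D : Matrix μ ν ℂ},
      (∀ᶠ s in cobounded ℂ, D + C * (s • (1 : Matrix ι ι ℂ) - A)⁻¹ * K = 0) →
      ∀ᶠ s in cobounded ℂ, C * K + C * A * (s • (1 : Matrix ι ι ℂ) - A)⁻¹ * K = 0 := by
    intro C D h
    have hD := key h
    filter_upwards [h, hspec] with s hs hsA
    have h1 : A * (s • (1 : Matrix ι ι ℂ) - A)⁻¹ = s • (s • (1 : Matrix ι ι ℂ) - A)⁻¹ - 1 := by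
      have := Matrix.mul_nonsing_inv _ (isUnit_smul_one_sub hsA)
      rw [Matrix.sub_mul, Matrix.smul_mul, Matrix.one_mul] at this
      exact eq_sub_of_add_eq (sub_eq_iff_eq_add'.1 this).symm
    rw [hD, zero_add] at hs
    rw [Matrix.mul_assoc C A, h1, Matrix.mul_sub, Matrix.sub_mul, Matrix.mul_smul,
      Matrix.smul_mul, hs, Matrix.mul_one, smul_zero]
    abel
  induction j with
  | zero =>
    intro C D h
    exact ⟨key h, by simpa using key (step h)⟩
  | succ j ih =>
    intro C D h
    refine ⟨key h, ?_⟩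
    rw [pow_succ', ← Matrix.mul_assoc C]
    exact (ih (step h)).2

theorem fromBlocks_diag_pow (A : Matrix ι ι ℂ) (B : Matrix κ κ ℂ) (j : ℕ) :
    (Matrix.fromBlocks A 0 0 B) ^ j = Matrix.fromBlocks (A ^ j) 0 0 (B ^ j) := by
  induction j with
  | zero => simp
  | succ j ih => rw [pow_succ, ih, Matrix.fromBlocks_multiply]; simp [pow_succ]

theorem mem_spectrum_fromBlocks {A : Matrix ι ι ℂ} {B : Matrix κ κ ℂ} {z : ℂ} :
    z ∈ spectrum ℂ (Matrix.fromBlocks A 0 0 B) ↔ z ∈ spectrum ℂ A ∨ z ∈ spectrum ℂ B := by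
  rw [Matrix.mem_spectrum_iff_isRoot_charpoly, Matrix.charpoly_fromBlocks_zero₁₂,
    Polynomial.root_mul, ← Matrix.mem_spectrum_iff_isRoot_charpoly,
    ← Matrix.mem_spectrum_iff_isRoot_charpoly]

theorem isHurwitz_fromBlocks {A : Matrix ι ι ℂ} {B : Matrix κ κ ℂ} (hA : IsHurwitz A)
    (hB : IsHurwitz B) : IsHurwitz (Matrix.fromBlocks A 0 0 B) :=
  fun z hz => (mem_spectrum_fromBlocks.1 hz).elim (hA z) (hB z)

theorem fromBlocks_resolvent {A : Matrix ι ι ℂ} {B : Matrix κ κ ℂ} {s : ℂ}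
    (hA : s ∉ spectrum ℂ A) (hB : s ∉ spectrum ℂ B) :
    (s • (1 : Matrix (ι ⊕ κ) (ι ⊕ κ) ℂ) - Matrix.fromBlocks A 0 0 B)⁻¹ =
      Matrix.fromBlocks (s • (1 : Matrix ι ι ℂ) - A)⁻¹ 0 0
        (s • (1 : Matrix κ κ ℂ) - B)⁻¹ := by
  apply Matrix.inv_eq_right_inv
  have : s • (1 : Matrix (ι ⊕ κ) (ι ⊕ κ) ℂ) - Matrix.fromBlocks A 0 0 B =
      Matrix.fromBlocks (s • (1 : Matrix ι ι ℂ) - A) 0 0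
        (s • (1 : Matrix κ κ ℂ) - B) := by
    rw [← Matrix.fromBlocks_one, Matrix.fromBlocks_smul, sub_eq_add_neg,
      Matrix.fromBlocks_neg, Matrix.fromBlocks_add]
    simp [sub_eq_add_neg]
  rw [this, Matrix.fromBlocks_multiply, Matrix.mul_nonsing_inv _ (isUnit_smul_one_sub hA),
    Matrix.mul_nonsing_inv _ (isUnit_smul_one_sub hB)]
  simp

open Filter Bornology in
/-- Additive separation of the stable and the antistable part of a rational function. -/
theorem separation {A : Matrix ι ι ℂ} {B : Matrix κ κ ℂ} (hA : IsHurwitz A)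
    (hB : IsHurwitz (-B)) {C : Matrix μ ι ℂ} {K : Matrix ι ν ℂ} {C' : Matrix μ κ ℂ}
    {K' : Matrix κ ν ℂ} {D : Matrix μ ν ℂ}
    (h : ∀ᶠ s in cobounded ℂ, D + C * (s • (1 : Matrix ι ι ℂ) - A)⁻¹ * K
      + C' * (s • (1 : Matrix κ κ ℂ) - B)⁻¹ * K' = 0) :
    D = 0 ∧ ∀ j, C * A ^ j * K = 0 := by
  have hAs : ∀ᶠ s in cobounded ℂ, s ∉ spectrum ℂ A := (Matrix.finite_spectrum A).isBounded
  have hBs : ∀ᶠ s in cobounded ℂ, s ∉ spectrum ℂ B := (Matrix.finite_spectrum B).isBounded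
  have h' : ∀ᶠ s in cobounded ℂ, D + Matrix.fromCols C C' *
      (s • (1 : Matrix (ι ⊕ κ) (ι ⊕ κ) ℂ) - Matrix.fromBlocks A 0 0 B)⁻¹ *
      Matrix.fromRows K K' = 0 := by
    filter_upwards [h, hAs, hBs] with s hs h1 h2
    have hinv := fromBlocks_resolvent h1 h2
    rw [hinv, Matrix.fromCols_mul_fromBlocks, Matrix.fromCols_mul_fromRows, ← hs]
    simp [add_assoc]
  refine ⟨(markov_eq_zero 0 h').1, fun j => ?_⟩
  -- The spectra lie in opposite open half planes.
  have hcop : IsCoprime A.charpoly B.charpoly := by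
    rw [Polynomial.isCoprime_iff_aeval_ne_zero_of_isAlgClosed ℂ ℂ]
    intro a
    by_contra! hcon
    have h1 := hA a (Matrix.mem_spectrum_iff_isRoot_charpoly.2 (by simpa using hcon.1))
    have h2 : a ∈ spectrum ℂ B :=
      Matrix.mem_spectrum_iff_isRoot_charpoly.2 (by simpa using hcon.2)
    have h3 := hB (-a) (by rw [← spectrum.neg_eq]; simpa using h2)
    simp at h3
    linarith
  obtain ⟨u, v, huv⟩ := hcop
  have hsum : ∀ p : ℂ[X], C * aeval A p * K + C' * aeval B p * K' = 0 := by
    intro p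
    have hmk : ∀ j, C * A ^ j * K + C' * B ^ j * K' = 0 := fun j => by
      have := (markov_eq_zero j h').2
      rw [fromBlocks_diag_pow, Matrix.fromCols_mul_fromBlocks, Matrix.fromCols_mul_fromRows] at this
      simpa using this
    induction p using Polynomial.induction_on' with
    | add p q hp hq =>
      rw [map_add, map_add]
      simp only [Matrix.mul_add, Matrix.add_mul]
      rw [add_add_add_comm, hp, hq, add_zero]
    | monomial j a =>
      rw [aeval_monomial, aeval_monomial]
      simp only [Algebra.algebraMap_eq_smul_one, Matrix.smul_mul, Matrix.one_mul,
        Matrix.mul_smul]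
      rw [← smul_add, hmk, smul_zero]
  -- By Bézout and Cayley–Hamilton this polynomial is A^j at A and 0 at B, so it isolates the stable
  -- summand.
  have h1 := hsum (v * B.charpoly * X ^ j)
  have hvA : aeval A (v * B.charpoly) = 1 := by
    have := congrArg (aeval A) huv
    rw [map_add, map_mul _ u, Matrix.aeval_self_charpoly, mul_zero, zero_add, map_one] at this
    exact this
  have hvB : aeval B (v * B.charpoly) = 0 := by
    rw [map_mul, Matrix.aeval_self_charpoly, mul_zero]
  rw [map_mul, hvA, map_mul _ (v * B.charpoly), hvB] at h1
  simpa using h1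

/-- State-valued matrices may be compared through their outputs. All identities for intertwiners
below are reduced to this. -/
theorem eq_of_observable {A : Matrix ι ι ℂ} {C : Matrix μ ι ℂ}
    (hobs : ∀ x, (∀ j, (C * A ^ j) *ᵥ x = 0) → x = 0) {X Y : Matrix ι ν ℂ}
    (h : ∀ j, C * A ^ j * X = C * A ^ j * Y) : X = Y := by
  have : ∀ k, (X - Y) *ᵥ Pi.single k 1 = 0 := fun k => hobs _ fun j => by
    rw [Matrix.mulVec_mulVec, Matrix.mul_sub, h j, sub_self, Matrix.zero_mulVec]
  rw [← sub_eq_zero]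
  ext i k
  simpa using congrFun (this k) i

/-- Systems with the same Markov parameters, the first observable and the second controllable,
are intertwined. -/
theorem exists_intertwiner {A₁ : Matrix ι ι ℂ} {C₁ : Matrix μ ι ℂ} {K₁ : Matrix ι ν ℂ}
    {A₂ : Matrix κ κ ℂ} {C₂ : Matrix μ κ ℂ} {K₂ : Matrix κ ν ℂ}
    (h : ∀ j, C₁ * A₁ ^ j * K₁ = C₂ * A₂ ^ j * K₂)
    (hobs : ∀ x, (∀ j, (C₁ * A₁ ^ j) *ᵥ x = 0) → x = 0)
    (hctr : ∀ y, (∀ j, y ᵥ* (A₂ ^ j * K₂) = 0) → y = 0) :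
    ∃ T : Matrix ι κ ℂ, ∀ j, C₁ * A₁ ^ j * T = C₂ * A₂ ^ j := by
  let O₁ : (ι → ℂ) →ₗ[ℂ] (ℕ → μ → ℂ) := LinearMap.pi fun j => (C₁ * A₁ ^ j).mulVecLin
  let O₂ : (κ → ℂ) →ₗ[ℂ] (ℕ → μ → ℂ) := LinearMap.pi fun j => (C₂ * A₂ ^ j).mulVecLin
  let R₁ : (ℕ →₀ (ν → ℂ)) →ₗ[ℂ] (ι → ℂ) :=
    Finsupp.lsum ℂ fun j => (A₁ ^ j * K₁).mulVecLin
  let R₂ : (ℕ →₀ (ν → ℂ)) →ₗ[ℂ] (κ → ℂ) :=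
    Finsupp.lsum ℂ fun j => (A₂ ^ j * K₂).mulVecLin
  -- Both sides are the block Hankel operator of the common Markov parameters, factored as
  -- observability after reachability.
  have hOR : O₁ ∘ₗ R₁ = O₂ ∘ₗ R₂ := by
    refine Finsupp.lhom_ext fun j x => funext fun i => ?_
    have e1 : C₁ * A₁ ^ i * (A₁ ^ j * K₁) = C₁ * A₁ ^ (i + j) * K₁ := by
      rw [pow_add]; simp only [Matrix.mul_assoc]
    have e2 : C₂ * A₂ ^ i * (A₂ ^ j * K₂) = C₂ * A₂ ^ (i + j) * K₂ := by
      rw [pow_add]; simp only [Matrix.mul_assoc]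
    have e3 := congrArg (· *ᵥ x) (e1.trans ((h _).trans e2.symm))
    simpa [O₁, O₂, R₁, R₂, Matrix.mul_assoc] using e3
  have hker : LinearMap.ker O₁ = ⊥ := by
    rw [LinearMap.ker_eq_bot']
    intro x hx
    exact hobs x fun j => congrFun hx j
  have hrange : LinearMap.range R₂ = ⊤ := by
    by_contra hne
    obtain ⟨f, hf0, hf⟩ := Submodule.exists_le_ker_of_lt_top _ (lt_top_iff_ne_top.2 hne)
    have hfy : ∀ x, f x = (fun i => f (Pi.single i 1)) ⬝ᵥ x := fun x => by
      conv_lhs => rw [pi_eq_sum_univ' x, map_sum]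
      simp [dotProduct, mul_comm]
    have hy : (fun i => f (Pi.single i 1)) = 0 := hctr _ fun j => by
      ext k
      have := hf (LinearMap.mem_range_self R₂ (Finsupp.single j (Pi.single k 1)))
      rw [LinearMap.mem_ker, hfy] at this
      simp only [R₂, Finsupp.lsum_single, Matrix.mulVecLin_apply, Matrix.mulVec_single_one] at this
      exact this
    exact hf0 (LinearMap.ext fun x => by rw [hfy, hy]; simp)
  -- As `R₂` is onto, the range of `O₂` lies in that of `O₁`, where any left inverse of `O₁` is a
  -- true inverse. So L ∘ O₂ intertwines.
  obtain ⟨L, hL⟩ := O₁.exists_leftInverse_of_injective hker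
  have key : O₁ ∘ₗ L ∘ₗ O₂ = O₂ := by
    refine LinearMap.ext fun x => ?_
    obtain ⟨w, rfl⟩ := LinearMap.range_eq_top.1 hrange x
    have h1 : O₂ (R₂ w) = O₁ (R₁ w) := (LinearMap.congr_fun hOR w).symm
    have h2 : L (O₁ (R₁ w)) = R₁ w := LinearMap.congr_fun hL _
    simp only [LinearMap.comp_apply, h1, h2]
  refine ⟨LinearMap.toMatrix' (L ∘ₗ O₂), fun j => ?_⟩
  apply Matrix.toLin'.injective
  refine LinearMap.ext fun x => ?_
  have := congrFun (LinearMap.congr_fun key x) j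
  rw [Matrix.toLin'_mul, Matrix.toLin'_toMatrix']
  exact this

/-- State space isomorphism theorem. -/
theorem exists_similarity {A₁ : Matrix ι ι ℂ} {C₁ : Matrix μ ι ℂ} {K₁ : Matrix ι ν ℂ}
    {A₂ : Matrix κ κ ℂ} {C₂ : Matrix μ κ ℂ} {K₂ : Matrix κ ν ℂ}
    (h : ∀ j, C₁ * A₁ ^ j * K₁ = C₂ * A₂ ^ j * K₂)
    (hobs₁ : ∀ x, (∀ j, (C₁ * A₁ ^ j) *ᵥ x = 0) → x = 0)
    (hobs₂ : ∀ x, (∀ j, (C₂ * A₂ ^ j) *ᵥ x = 0) → x = 0)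
    (hctr₁ : ∀ y, (∀ j, y ᵥ* (A₁ ^ j * K₁) = 0) → y = 0)
    (hctr₂ : ∀ y, (∀ j, y ᵥ* (A₂ ^ j * K₂) = 0) → y = 0) :
    ∃ (T : Matrix ι κ ℂ) (T' : Matrix κ ι ℂ), T * T' = 1 ∧ T' * T = 1 ∧
      C₁ * T = C₂ ∧ A₁ * T = T * A₂ := by
  obtain ⟨T, hT⟩ := exists_intertwiner h hobs₁ hctr₂
  obtain ⟨T', hT'⟩ := exists_intertwiner (fun j => (h j).symm) hobs₂ hctr₁
  refine ⟨T, T', eq_of_observable hobs₁ fun j => ?_, eq_of_observable hobs₂ fun j => ?_, ?_,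
    eq_of_observable hobs₁ fun j => ?_⟩
  · rw [← Matrix.mul_assoc, hT, hT', Matrix.mul_one]
  · rw [← Matrix.mul_assoc, hT', hT, Matrix.mul_one]
  · simpa using hT 0
  · rw [← Matrix.mul_assoc, Matrix.mul_assoc C₁, ← pow_succ, hT, ← Matrix.mul_assoc, hT, pow_succ,
      Matrix.mul_assoc]

end LinearAlgebra

/-! ### The adjoint ♭, the doubled-up conjugation and symplectic matrices. -/

section DoubledUp

variable {k l n m : ℕ}

theorem J_mul_J (n : ℕ) : J n * J n = 1 := by
  simp [J, Matrix.fromBlocks_multiply]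

theorem J_mul_J_mul {ν : Type*} (X : Matrix (Dbl n) ν ℂ) : J n * (J n * X) = X := by
  rw [← Matrix.mul_assoc, J_mul_J, Matrix.one_mul]

theorem mul_J_mul_J {ν : Type*} (X : Matrix ν (Dbl n) ℂ) : X * J n * J n = X := by
  rw [Matrix.mul_assoc, J_mul_J, Matrix.mul_one]

theorem J_mulVec_J_mulVec (x : Dbl n → ℂ) : J n *ᵥ (J n *ᵥ x) = x := by
  rw [Matrix.mulVec_mulVec, J_mul_J, Matrix.one_mulVec]

theorem conjTranspose_J (n : ℕ) : (J n)ᴴ = J n := by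
  simp [J, Matrix.fromBlocks_conjTranspose]

/-- Symplectic matrices preserve the J part, so a vacuum output covariance carries exactly the
information of S S^†. -/
theorem Vvac_eq (m : ℕ) : Vvac m = (1 / 2 : ℂ) • (1 + J m) := by
  rw [Vvac, J, ← Matrix.fromBlocks_one, Matrix.fromBlocks_add, Matrix.fromBlocks_smul]
  congr 1
  · rw [← two_smul ℂ (1 : Matrix (Fin m) (Fin m) ℂ), smul_smul]; norm_num
  all_goals simp

theorem flat_mul (X : Matrix (Dbl k) (Dbl l) ℂ) (Y : Matrix (Dbl l) (Dbl n) ℂ) :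
    flat (X * Y) = flat Y * flat X := by
  simp only [flat, Matrix.conjTranspose_mul, Matrix.mul_assoc, J_mul_J_mul]

theorem flat_flat (X : Matrix (Dbl k) (Dbl n) ℂ) : flat (flat X) = X := by
  simp only [flat, Matrix.conjTranspose_mul, conjTranspose_J, Matrix.conjTranspose_conjTranspose,
    Matrix.mul_assoc, J_mul_J_mul, J_mul_J, Matrix.mul_one]

theorem flat_sub (X Y : Matrix (Dbl k) (Dbl n) ℂ) : flat (X - Y) = flat X - flat Y := by
  simp only [flat, Matrix.conjTranspose_sub, Matrix.mul_sub, Matrix.sub_mul]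

theorem flat_neg (X : Matrix (Dbl k) (Dbl n) ℂ) : flat (-X) = -flat X := by
  simp only [flat, Matrix.conjTranspose_neg, Matrix.mul_neg, Matrix.neg_mul]

theorem flat_smul (c : ℂ) (X : Matrix (Dbl k) (Dbl n) ℂ) : flat (c • X) = conj c • flat X := by
  simp only [flat, Matrix.conjTranspose_smul, Matrix.mul_smul, Matrix.smul_mul]
  rfl

theorem J_mul_flat (X : Matrix (Dbl k) (Dbl n) ℂ) : J n * flat X = Xᴴ * J k := by
  simp only [flat, Matrix.mul_assoc, J_mul_J_mul]

theorem flat_mul_J (X : Matrix (Dbl k) (Dbl n) ℂ) : flat X * J k = J n * Xᴴ := by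
  simp only [flat, mul_J_mul_J]

theorem conjTranspose_flat (X : Matrix (Dbl k) (Dbl n) ℂ) : (flat X)ᴴ = J k * X * J n := by
  simp only [flat, Matrix.conjTranspose_mul, conjTranspose_J, Matrix.conjTranspose_conjTranspose,
    Matrix.mul_assoc]

/-- The conjugation whose fixed points are the doubled-up matrices. -/
def bar (X : Matrix (Dbl k) (Dbl n) ℂ) : Matrix (Dbl k) (Dbl n) ℂ :=
  (X.map (starRingEnd ℂ)).submatrix Sum.swap Sum.swap

/-- The conjugation whose fixed points are the doubled-up vectors. -/
def vbar (x : Dbl n → ℂ) : Dbl n → ℂ := fun i => conj (x i.swap)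

theorem vbar_vbar (x : Dbl n → ℂ) : vbar (vbar x) = x := by
  funext i; simp [vbar]

theorem vbar_smul (c : ℂ) (x : Dbl n → ℂ) : vbar (c • x) = conj c • vbar x := by
  funext i; simp [vbar]

theorem vbar_zero : vbar (0 : Dbl n → ℂ) = 0 := by
  funext i; simp [vbar]

theorem star_vbar (x : Dbl n → ℂ) : star (vbar x) = vbar (star x) := by
  funext i; simp [vbar]

theorem vbar_dotProduct_vbar (x y : Dbl n → ℂ) : vbar x ⬝ᵥ vbar y = conj (x ⬝ᵥ y) := by
  simp only [dotProduct, vbar, map_sum, map_mul]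
  exact Fintype.sum_equiv (Equiv.sumComm _ _) _ _ fun i => rfl

theorem bar_mulVec_vbar (X : Matrix (Dbl k) (Dbl n) ℂ) (x : Dbl n → ℂ) :
    bar X *ᵥ vbar x = vbar (X *ᵥ x) := by
  funext i
  simp only [Matrix.mulVec, dotProduct, vbar, map_sum, map_mul, bar, Matrix.submatrix_apply,
    Matrix.map_apply]
  exact Fintype.sum_equiv (Equiv.sumComm _ _) _ _ fun i => rfl

theorem bar_mul (X : Matrix (Dbl k) (Dbl l) ℂ) (Y : Matrix (Dbl l) (Dbl n) ℂ) :
    bar (X * Y) = bar X * bar Y := by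
  have := Matrix.submatrix_mul_equiv (X.map (starRingEnd ℂ)) (Y.map (starRingEnd ℂ)) Sum.swap
    (Equiv.sumComm (Fin l) (Fin l)) Sum.swap
  rw [bar, Matrix.map_mul, ← this]
  rfl

theorem bar_add (X Y : Matrix (Dbl k) (Dbl n) ℂ) : bar (X + Y) = bar X + bar Y := by
  ext i j; simp [bar]

theorem bar_sub (X Y : Matrix (Dbl k) (Dbl n) ℂ) : bar (X - Y) = bar X - bar Y := by
  ext i j; simp [bar]

theorem bar_neg (X : Matrix (Dbl k) (Dbl n) ℂ) : bar (-X) = -bar X := by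
  ext i j; simp [bar]

theorem bar_smul (c : ℂ) (X : Matrix (Dbl k) (Dbl n) ℂ) : bar (c • X) = conj c • bar X := by
  ext i j; simp [bar]

theorem bar_conjTranspose (X : Matrix (Dbl k) (Dbl n) ℂ) : bar Xᴴ = (bar X)ᴴ := by
  ext i j; simp [bar]

/-- The sign cancels in ♭, where J occurs twice, and against the conjugate of i in −iJΩ. Hence ♭ and
the system matrix respect the doubled-up structure. -/
theorem bar_J (n : ℕ) : bar (J n) = -J n := by
  ext (i | i) (j | j) <;> simp [bar, J, Matrix.one_apply]

theorem bar_flat (X : Matrix (Dbl k) (Dbl n) ℂ) : bar (flat X) = flat (bar X) := by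
  simp only [flat, bar_mul, bar_J, bar_conjTranspose, Matrix.neg_mul, Matrix.mul_neg, neg_neg]

theorem bar_eq_iff (X : Matrix (Dbl k) (Dbl n) ℂ) :
    bar X = X ↔ ∃ Y Z : Matrix (Fin k) (Fin n) ℂ, X = Delta Y Z := by
  constructor
  · intro h
    refine ⟨X.toBlocks₁₁, X.toBlocks₁₂, ?_⟩
    conv_lhs => rw [← X.fromBlocks_toBlocks]
    rw [Delta]
    congr 1 <;> ext i j
    · exact (congrFun (congrFun h (Sum.inr i)) (Sum.inl j)).symm
    · exact (congrFun (congrFun h (Sum.inr i)) (Sum.inr j)).symm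
  · rintro ⟨Y, Z, rfl⟩
    ext (i | i) (j | j) <;> simp [bar, Delta]

theorem bar_Delta (Y Z : Matrix (Fin k) (Fin n) ℂ) : bar (Delta Y Z) = Delta Y Z :=
  (bar_eq_iff _).2 ⟨Y, Z, rfl⟩

theorem isSymplectic_iff (T : Matrix (Dbl k) (Dbl n) ℂ) :
    IsSymplectic T ↔ flat T * T = 1 ∧ T * flat T = 1 ∧ bar T = T := by
  rw [IsSymplectic, bar_eq_iff]

theorem IsSymplectic.flat {T : Matrix (Dbl k) (Dbl n) ℂ} (h : IsSymplectic T) :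
    IsSymplectic (flat T) := by
  rw [isSymplectic_iff] at *
  exact ⟨by rw [flat_flat]; exact h.2.1, by rw [flat_flat]; exact h.1, by rw [bar_flat, h.2.2]⟩

theorem IsSymplectic.mul {T : Matrix (Dbl k) (Dbl l) ℂ} {T' : Matrix (Dbl l) (Dbl n) ℂ}
    (h : IsSymplectic T) (h' : IsSymplectic T') : IsSymplectic (T * T') := by
  rw [isSymplectic_iff] at *
  refine ⟨?_, ?_, by rw [bar_mul, h.2.2, h'.2.2]⟩
  · rw [flat_mul, Matrix.mul_assoc, ← Matrix.mul_assoc _ T, h.1, Matrix.one_mul, h'.1]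
  · rw [flat_mul, Matrix.mul_assoc, ← Matrix.mul_assoc T', h'.2.1, Matrix.one_mul, h.2.1]

theorem IsSymplectic.eq_dim {T : Matrix (Dbl k) (Dbl n) ℂ} (h : IsSymplectic T) : k = n := by
  have h1 := congrArg Matrix.trace h.1
  have h2 := congrArg Matrix.trace h.2.1
  rw [Matrix.trace_mul_comm, h2, Matrix.trace_one, Matrix.trace_one] at h1
  simp only [Fintype.card_sum, Fintype.card_fin] at h1
  norm_cast at h1
  omega

theorem IsSymplectic.mul_J_mul {S : Matrix (Dbl k) (Dbl n) ℂ} (h : IsSymplectic S) :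
    S * J n * Sᴴ = J k := by
  have := congrArg (· * J k) h.2.1
  simpa [QuantumLinear.flat, Matrix.mul_assoc, J_mul_J] using this

theorem IsSymplectic.conjTranspose_mul_J_mul {S : Matrix (Dbl k) (Dbl n) ℂ}
    (h : IsSymplectic S) : Sᴴ * J k * S = J n := by
  have := congrArg (J n * ·) h.1
  simpa [QuantumLinear.flat, Matrix.mul_assoc, J_mul_J_mul] using this

theorem IsSymplectic.mul_Vvac_mul {S : Matrix (Dbl m) (Dbl m) ℂ} (h : IsSymplectic S) :
    S * Vvac m * Sᴴ = (1 / 2 : ℂ) • (S * Sᴴ + J m) := by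
  rw [Vvac_eq, Matrix.mul_smul, Matrix.smul_mul, Matrix.mul_add, Matrix.add_mul, Matrix.mul_one,
    h.mul_J_mul]

theorem IsPassive.mul_Vvac_mul {U : Matrix (Dbl m) (Dbl m) ℂ} (h : IsPassive U) :
    U * Vvac m * Uᴴ = Vvac m := by
  have h2 : U * Uᴴ = 1 := Matrix.mem_unitaryGroup_iff.1 h.2
  rw [h.1.mul_Vvac_mul, h2, Vvac_eq]

/-- Scattering matrices with the same vacuum output covariance differ by a passive one. -/
theorem exists_passive {S₁ S₂ : Matrix (Dbl m) (Dbl m) ℂ} (h₁ : IsSymplectic S₁)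
    (h₂ : IsSymplectic S₂) (h : S₁ * Vvac m * S₁ᴴ = S₂ * Vvac m * S₂ᴴ) :
    ∃ U, IsPassive U ∧ S₁ = S₂ * U := by
  have h3 : S₁ * S₁ᴴ = S₂ * S₂ᴴ := by
    rw [h₁.mul_Vvac_mul, h₂.mul_Vvac_mul] at h
    exact add_right_cancel (smul_right_injective _ (by norm_num : (1 / 2 : ℂ) ≠ 0) h)
  refine ⟨flat S₂ * S₁, ⟨h₂.flat.mul h₁, ?_⟩, by rw [← Matrix.mul_assoc, h₂.2.1, Matrix.one_mul]⟩
  rw [Matrix.mem_unitaryGroup_iff, Matrix.star_eq_conjTranspose, Matrix.conjTranspose_mul,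
    Matrix.mul_assoc, ← Matrix.mul_assoc S₁, h3, Matrix.mul_assoc S₂, ← Matrix.mul_assoc _ S₂,
    h₂.1, Matrix.one_mul, ← Matrix.conjTranspose_mul, h₂.1, Matrix.conjTranspose_one]

end DoubledUp

/-! ### Physical realizability and observability. -/

namespace QLS

variable {n m : ℕ} (G : QLS n m)

theorem bar_S : bar G.S = G.S := bar_Delta _ _

theorem bar_C : bar G.C = G.C := bar_Delta _ _

theorem bar_Omega : bar G.Omega = G.Omega := bar_Delta _ _

theorem bar_A : bar G.A = G.A := by
  simp only [A, bar_sub, bar_neg, bar_smul, bar_mul, bar_flat, bar_C, bar_J, bar_Omega,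
    Complex.conj_I, map_div₀, map_one, map_ofNat, Matrix.neg_mul, smul_neg, neg_smul, neg_neg]

theorem isSymplectic_S : IsSymplectic G.S := G.symplectic_S

theorem conjTranspose_Omega : G.Omegaᴴ = G.Omega := by
  have h : G.OmegaPlusᴴ = G.OmegaPlus.map (starRingEnd ℂ) := by
    conv_rhs => rw [← G.symmetric_OmegaPlus]
    rfl
  have h' : (G.OmegaPlus.map (starRingEnd ℂ))ᴴ = G.OmegaPlus := by
    rw [← h, Matrix.conjTranspose_conjTranspose]
  have h2 : (G.OmegaMinus.map (starRingEnd ℂ))ᴴ = G.OmegaMinus.map (starRingEnd ℂ) := by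
    conv_rhs => rw [← G.hermitian_OmegaMinus]
    rfl
  rw [Omega, Delta, Matrix.fromBlocks_conjTranspose, h, h', h2, G.hermitian_OmegaMinus]

theorem flat_A : flat G.A = -((1 / 2 : ℂ) • (flat G.C * G.C)) + Complex.I • (J n * G.Omega) := by
  have h : flat (J n * G.Omega) = J n * G.Omega := by
    simp only [flat, Matrix.conjTranspose_mul, conjTranspose_J, conjTranspose_Omega,
      Matrix.mul_assoc, J_mul_J, Matrix.mul_one]
  rw [A, flat_sub, flat_neg, flat_smul, flat_smul, flat_mul, flat_flat, h]
  simp only [map_div₀, map_one, map_ofNat, Complex.conj_I, neg_smul, sub_neg_eq_add]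

/-- The Hamiltonian term JΩ is ♭-self-adjoint, so −iJΩ cancels from A + A^♭. -/
theorem flat_A_eq : flat G.A = -G.A - flat G.C * G.C := by
  rw [flat_A, A]
  module

/-- Preservation of the commutation relations, written as a Lyapunov equation for J so that it can
be added to the one for Q. -/
theorem A_mul_J : G.A * J n + J n * G.Aᴴ = -(flat G.C * (G.C * J n)) := by
  have := congrArg (· * J n) G.flat_A_eq
  simp only [flat_mul_J, Matrix.sub_mul, Matrix.neg_mul, Matrix.mul_assoc] at this
  rw [this]; abel

/-- Stable systems are observable. -/
theorem observable (h : G.IsStable) (x : Dbl n → ℂ) (hx : ∀ j, (G.C * G.A ^ j) *ᵥ x = 0) :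
    x = 0 := by
  by_contra hne
  let p : Submodule ℂ (Dbl n → ℂ) := ⨅ j, LinearMap.ker (G.C * G.A ^ j).mulVecLin
  have hmem : ∀ y, y ∈ p ↔ ∀ j, (G.C * G.A ^ j) *ᵥ y = 0 := fun y => by
    simp [p, Submodule.mem_iInf]
  obtain ⟨z, y, hy, hy0, hyz⟩ := exists_eigenvector_mem G.A.mulVecLin p
    (fun y hy => (hmem _).2 fun j => by
      have := (hmem y).1 hy (j + 1)
      rwa [pow_succ, ← Matrix.mul_assoc, ← Matrix.mulVec_mulVec] at this)
    (fun hbot => hne ((Submodule.eq_bot_iff p).1 hbot x ((hmem x).2 hx)))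
  have hC : G.C *ᵥ y = 0 := by simpa using (hmem y).1 hy 0
  have hA : G.A *ᵥ y = z • y := hyz
  have h1 := h z (mem_spectrum_of_mulVec hy0 hA)
  -- On an unobservable eigenvector the dissipative term vanishes and A^♭ acts as −A, so −z̄ would
  -- also be an eigenvalue of A.
  have h2 : G.Aᴴ *ᵥ (J n *ᵥ y) = (-z) • (J n *ᵥ y) := by
    have h3 : flat G.A *ᵥ y = -(z • y) := by
      rw [flat_A_eq, Matrix.sub_mulVec, Matrix.neg_mulVec, hA, ← Matrix.mulVec_mulVec, hC,
        Matrix.mulVec_zero, sub_zero]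
    have h4 := congrArg (J n *ᵥ ·) h3
    simp only [Matrix.mulVec_mulVec, J_mul_flat] at h4
    rw [Matrix.mulVec_mulVec, h4, Matrix.mulVec_neg, Matrix.mulVec_smul, neg_smul]
  have h0 : J n *ᵥ y ≠ 0 := fun h0 => hy0 (by rw [← J_mulVec_J_mulVec y, h0, Matrix.mulVec_zero])
  have h5 := (IsHurwitz.conjTranspose h) _ (mem_spectrum_of_mulVec h0 h2)
  simp at h5
  linarith

end QLS

/-! ### Compressions, equivalent systems and the partial fractions of the power spectrum. -/

namespace QLS

variable {n m k : ℕ} (G : QLS n m)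

/-- Compression of a system along a doubled-up matrix `E`, with a new scattering matrix. -/
theorem exists_compression (E : Matrix (Dbl n) (Dbl k) ℂ) (hE : bar E = E)
    {U : Matrix (Dbl m) (Dbl m) ℂ} (hU : IsSymplectic U) :
    ∃ G' : QLS k m, G'.S = U ∧ G'.C = G.C * E ∧ G'.Omega = Eᴴ * G.Omega * E ∧
      G'.A = flat E * G.A * E := by
  obtain ⟨Sm, Sp, hS⟩ := hU.2.2
  obtain ⟨Cm, Cp, hC⟩ := (bar_eq_iff (G.C * E)).1 (by rw [bar_mul, hE, bar_C])
  obtain ⟨Om, Op, hO⟩ := (bar_eq_iff (Eᴴ * G.Omega * E)).1 (by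
    rw [bar_mul, bar_mul, bar_conjTranspose, hE, bar_Omega])
  have hherm : (Delta Om Op)ᴴ = Delta Om Op := by
    rw [← hO]
    simp only [Matrix.conjTranspose_mul, Matrix.conjTranspose_conjTranspose, conjTranspose_Omega,
      Matrix.mul_assoc]
  rw [Delta, Matrix.fromBlocks_conjTranspose, Matrix.fromBlocks_inj] at hherm
  have hsymm : Opᵀ = Op := by
    rw [← hherm.2.1]
    ext i j
    simpa using congrFun (congrFun hherm.2.1 j) i
  let G' : QLS k m :=
    { Sminus := Sm
      Splus := Sp
      Cminus := Cm
      Cplus := Cp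
      OmegaMinus := Om
      OmegaPlus := Op
      symplectic_S := hS ▸ hU
      hermitian_OmegaMinus := hherm.1
      symmetric_OmegaPlus := hsymm }
  have hC' : G'.C = G.C * E := hC.symm
  have hO' : G'.Omega = Eᴴ * G.Omega * E := hO.symm
  refine ⟨G', hS.symm, hC', hO', ?_⟩
  -- Both terms of A transform by X ↦ E^♭ X E. No isometry condition on E is needed here.
  have hJ : J k * (Eᴴ * G.Omega * E) = flat E * (J n * G.Omega) * E := by
    simp only [flat, Matrix.mul_assoc, J_mul_J_mul]
  rw [A, A, hC', hO', hJ, flat_mul]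
  simp only [Matrix.mul_sub, Matrix.sub_mul, Matrix.mul_neg, Matrix.neg_mul, Matrix.mul_smul,
    Matrix.smul_mul, Matrix.mul_assoc]

variable {n₁ n₂ : ℕ} {G₁ : QLS n₁ m} {G₂ : QLS n₂ m}

theorem J_mul_Omega : J n * G.Omega = Complex.I • (G.A + (1 / 2 : ℂ) • (flat G.C * G.C)) := by
  rw [A, sub_add_eq_add_sub, neg_add_cancel, zero_sub, smul_neg, smul_smul, Complex.I_mul_I,
    neg_one_smul, neg_neg]

/-- Matching couplings already match the terms C^♭C when conjugated by T, which leaves only the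
Hamiltonians to compare. -/
theorem A_eq_iff {T : Matrix (Dbl n₁) (Dbl n₂) ℂ} (hC : G₁.C = G₂.C * flat T) :
    J n₁ * G₁.Omega = T * (J n₂ * G₂.Omega) * flat T ↔ G₁.A = T * G₂.A * flat T := by
  have h : T * (flat G₂.C * G₂.C) * flat T = flat G₁.C * G₁.C := by
    rw [hC, flat_mul, flat_flat]; simp only [Matrix.mul_assoc]
  constructor
  · intro h1
    rw [A, A, h1, ← h]
    simp only [Matrix.mul_sub, Matrix.sub_mul, Matrix.mul_neg, Matrix.neg_mul, Matrix.mul_smul,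
      Matrix.smul_mul]
  · intro h1
    rw [J_mul_Omega, J_mul_Omega, h1, ← h]
    simp only [Matrix.mul_add, Matrix.add_mul, Matrix.mul_smul, Matrix.smul_mul]

theorem mul_resolvent_mul_flat {T : Matrix (Dbl n₁) (Dbl n₂) ℂ} (hT : IsSymplectic T)
    {A₁ : Matrix (Dbl n₁) (Dbl n₁) ℂ} {A₂ : Matrix (Dbl n₂) (Dbl n₂) ℂ}
    (hA : A₁ = T * A₂ * flat T) {s : ℂ} (hs : s ∉ spectrum ℂ A₂) :
    (s • (1 : Matrix (Dbl n₁) (Dbl n₁) ℂ) - A₁)⁻¹ =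
      T * (s • (1 : Matrix (Dbl n₂) (Dbl n₂) ℂ) - A₂)⁻¹ * flat T := by
  apply Matrix.inv_eq_right_inv
  have h1 : s • (1 : Matrix (Dbl n₁) (Dbl n₁) ℂ) - A₁ =
      T * (s • (1 : Matrix (Dbl n₂) (Dbl n₂) ℂ) - A₂) * flat T := by
    rw [hA, Matrix.mul_sub, Matrix.sub_mul, Matrix.mul_smul, Matrix.mul_one, Matrix.smul_mul,
      hT.2.1]
  rw [h1]
  calc T * (s • (1 : Matrix (Dbl n₂) (Dbl n₂) ℂ) - A₂) * flat T *
        (T * (s • (1 : Matrix (Dbl n₂) (Dbl n₂) ℂ) - A₂)⁻¹ * flat T)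
      = T * ((s • (1 : Matrix (Dbl n₂) (Dbl n₂) ℂ) - A₂) * (flat T * T) *
        (s • (1 : Matrix (Dbl n₂) (Dbl n₂) ℂ) - A₂)⁻¹) * flat T := by
          simp only [Matrix.mul_assoc]
    _ = 1 := by
      rw [hT.1, Matrix.mul_one, Matrix.mul_nonsing_inv _ (isUnit_smul_one_sub hs), Matrix.mul_one,
        hT.2.1]

theorem transferEqMul_of_symplectic {T : Matrix (Dbl n₁) (Dbl n₂) ℂ} (hT : IsSymplectic T)
    (hC : G₁.C = G₂.C * flat T) (hA : G₁.A = T * G₂.A * flat T)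
    {U : Matrix (Dbl m) (Dbl m) ℂ} (hS : G₁.S = G₂.S * U) : TransferEqMul G₁ G₂ U := by
  intro s _ hs
  have h : G₁.C * (T * (s • (1 : Matrix (Dbl n₂) (Dbl n₂) ℂ) - G₂.A)⁻¹ * flat T) * flat G₁.C =
      G₂.C * (flat T * T) * (s • (1 : Matrix (Dbl n₂) (Dbl n₂) ℂ) - G₂.A)⁻¹ * (flat T * T) *
        flat G₂.C := by
    rw [hC, flat_mul, flat_flat]; simp only [Matrix.mul_assoc]
  rw [transferFunction, transferFunction, mul_resolvent_mul_flat hT hA hs, h, hT.1,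
    Matrix.mul_one, Matrix.mul_one, hS, ← Matrix.mul_assoc _ G₂.S]

theorem TransferEqMul.samePowerSpectrum {U : Matrix (Dbl m) (Dbl m) ℂ} (hU : IsPassive U)
    (h : TransferEqMul G₁ G₂ U) : SamePowerSpectrum G₁ G₂ := by
  intro s h1 h2 h3 h4
  have h5 : ∀ X Y : Matrix (Dbl m) (Dbl m) ℂ,
      X * U * Vvac m * (Y * U)ᴴ = X * (U * Vvac m * Uᴴ) * Yᴴ := fun X Y => by
    simp only [Matrix.conjTranspose_mul, Matrix.mul_assoc]
  rw [powerSpectrum, powerSpectrum, h s h1 h2, h _ h3 h4, h5, hU.mul_Vvac_mul]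

theorem SamePowerSpectrum.symm (h : SamePowerSpectrum G₁ G₂) : SamePowerSpectrum G₂ G₁ :=
  fun s h1 h2 h3 h4 => (h s h2 h1 h4 h3).symm

/-- `Q` solves the Lyapunov equation `A Q + Q A^† + (1/2) C^♭ S S^† C^{♭†} = 0`; then `Q + J / 2`
is the stationary covariance of the modes. -/
def IsLyapunov (Q : Matrix (Dbl n) (Dbl n) ℂ) : Prop :=
  G.A * Q + Q * G.Aᴴ + (1 / 2 : ℂ) • (flat G.C * (G.S * G.Sᴴ) * (flat G.C)ᴴ) = 0

/-- The input matrix of the stable part of the power spectrum. -/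
noncomputable def inputMatrix (Q : Matrix (Dbl n) (Dbl n) ℂ) : Matrix (Dbl n) (Dbl m) ℂ :=
  Q * G.Cᴴ - (1 / 2 : ℂ) • (flat G.C * (G.S * G.Sᴴ))

variable {G}

theorem exists_isLyapunov (hG : G.IsStable) : ∃ Q, G.IsLyapunov Q := exists_lyapunov hG _

theorem IsLyapunov.unique (hG : G.IsStable) {Q Q' : Matrix (Dbl n) (Dbl n) ℂ}
    (h : G.IsLyapunov Q) (h' : G.IsLyapunov Q') : Q = Q' := by
  rw [← sub_eq_zero]
  refine eq_zero_of_sylvester hG (IsHurwitz.conjTranspose hG) ?_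
  have := congrArg₂ (· - ·) h h'
  simp only [sub_zero] at this
  rw [← this, Matrix.mul_sub, Matrix.sub_mul]
  abel

theorem IsLyapunov.conjTranspose (hG : G.IsStable) {Q : Matrix (Dbl n) (Dbl n) ℂ}
    (h : G.IsLyapunov Q) : Qᴴ = Q := by
  refine IsLyapunov.unique hG ?_ h
  have := congrArg Matrix.conjTranspose h
  simp only [Matrix.conjTranspose_add, Matrix.conjTranspose_mul, Matrix.conjTranspose_smul,
    Matrix.conjTranspose_conjTranspose, Matrix.conjTranspose_zero, Matrix.mul_assoc] at this
  rw [IsLyapunov, add_comm (G.A * Qᴴ), ← this]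
  simp [Matrix.mul_assoc]

theorem IsLyapunov.bar (hG : G.IsStable) {Q : Matrix (Dbl n) (Dbl n) ℂ}
    (h : G.IsLyapunov Q) : bar Q = Q := by
  refine IsLyapunov.unique hG ?_ h
  have := congrArg QuantumLinear.bar h
  simp only [bar_add, bar_smul, bar_mul, bar_flat, bar_conjTranspose, bar_A, bar_C, bar_S,
    map_div₀, map_one, map_ofNat] at this
  rw [IsLyapunov, this]
  ext i j; simp [QuantumLinear.bar]

theorem bar_inputMatrix {Q : Matrix (Dbl n) (Dbl n) ℂ} (hQ : QuantumLinear.bar Q = Q) :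
    QuantumLinear.bar (G.inputMatrix Q) = G.inputMatrix Q := by
  simp only [inputMatrix, bar_sub, bar_smul, bar_mul, bar_flat, bar_conjTranspose, bar_C, bar_S,
    hQ, map_div₀, map_one, map_ofNat]

/-- The J/2 in the covariance cancels the J/2 in S V_vac S^†. The definition through Q is the useful
one for symmetry: Q is fixed by `bar`, while Q + J/2 is not. -/
theorem inputMatrix_eq (Q : Matrix (Dbl n) (Dbl n) ℂ) :
    G.inputMatrix Q = (Q + (1 / 2 : ℂ) • J n) * G.Cᴴ - flat G.C * (G.S * Vvac m * G.Sᴴ) := by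
  rw [G.isSymplectic_S.mul_Vvac_mul, inputMatrix, Matrix.mul_smul, Matrix.mul_add, flat_mul_J,
    Matrix.add_mul, Matrix.smul_mul]
  module

theorem IsLyapunov.stationary {Q : Matrix (Dbl n) (Dbl n) ℂ} (h : G.IsLyapunov Q) :
    G.A * (Q + (1 / 2 : ℂ) • J n) + (Q + (1 / 2 : ℂ) • J n) * G.Aᴴ
      + flat G.C * (G.S * Vvac m * G.Sᴴ) * (flat G.C)ᴴ = 0 := by
  have h1 : flat G.C * J m * (flat G.C)ᴴ = flat G.C * (G.C * J n) := by
    rw [conjTranspose_flat]; simp only [Matrix.mul_assoc, J_mul_J_mul]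
  have h2 := G.A_mul_J
  rw [← add_eq_zero_iff_eq_neg] at h2
  rw [G.isSymplectic_S.mul_Vvac_mul, Matrix.mul_smul, Matrix.smul_mul, Matrix.mul_add _ _ (J m),
    Matrix.add_mul (flat G.C * _), h1]
  have h3 := congrArg₂ (fun X Y => X + (1 / 2 : ℂ) • Y) h h2
  simp only [smul_zero, add_zero] at h3
  rw [← h3]
  simp only [Matrix.mul_add, Matrix.add_mul, Matrix.mul_smul, Matrix.smul_mul, smul_add]
  abel

/-- Partial fraction decomposition of the power spectrum. -/
theorem powerSpectrum_eq (hG : G.IsStable) {Q : Matrix (Dbl n) (Dbl n) ℂ} (h : G.IsLyapunov Q)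
    {s : ℂ} (hs : s ∉ spectrum ℂ G.A) (hs' : -(conj s) ∉ spectrum ℂ G.A) :
    G.powerSpectrum s = G.S * Vvac m * G.Sᴴ
      + G.C * (s • (1 : Matrix (Dbl n) (Dbl n) ℂ) - G.A)⁻¹ * G.inputMatrix Q
      + (G.C * ((-(conj s)) • (1 : Matrix (Dbl n) (Dbl n) ℂ) - G.A)⁻¹ * G.inputMatrix Q)ᴴ := by
  have hP := h.stationary
  have hPh : (Q + (1 / 2 : ℂ) • J n)ᴴ = Q + (1 / 2 : ℂ) • J n := by
    rw [Matrix.conjTranspose_add, h.conjTranspose hG, Matrix.conjTranspose_smul, conjTranspose_J]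
    simp
  have hNh : (G.S * Vvac m * G.Sᴴ)ᴴ = G.S * Vvac m * G.Sᴴ := by
    have : (Vvac m)ᴴ = Vvac m := by simp [Vvac, Matrix.fromBlocks_conjTranspose]
    simp only [Matrix.conjTranspose_mul, Matrix.conjTranspose_conjTranspose, this,
      Matrix.mul_assoc]
  rw [inputMatrix_eq, powerSpectrum, transferFunction, transferFunction]
  generalize Q + (1 / 2 : ℂ) • J n = P at *
  have hX := Matrix.nonsing_inv_mul _ (isUnit_smul_one_sub hs)
  have hY := congrArg Matrix.conjTranspose (Matrix.nonsing_inv_mul _ (isUnit_smul_one_sub hs'))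
  generalize (s • (1 : Matrix (Dbl n) (Dbl n) ℂ) - G.A)⁻¹ = X at *
  generalize ((-(conj s)) • (1 : Matrix (Dbl n) (Dbl n) ℂ) - G.A)⁻¹ = Z at *
  have hY' : (-(s • (1 : Matrix (Dbl n) (Dbl n) ℂ)) - G.Aᴴ) * Zᴴ = 1 := by
    simpa [Matrix.conjTranspose_mul] using hY
  -- The stationarity equation writes the noise term as (s−A)P + P(−s−A^†), so the product of
  -- resolvents splits into a sum.
  have key : X * (flat G.C * (G.S * Vvac m * G.Sᴴ) * (flat G.C)ᴴ) * Zᴴ = X * P + P * Zᴴ := by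
    have h1 : flat G.C * (G.S * Vvac m * G.Sᴴ) * (flat G.C)ᴴ =
        (s • (1 : Matrix (Dbl n) (Dbl n) ℂ) - G.A) * P
          + P * (-(s • (1 : Matrix (Dbl n) (Dbl n) ℂ)) - G.Aᴴ) := by
      rw [← sub_eq_zero, ← hP]
      simp only [Matrix.mul_sub, Matrix.sub_mul, Matrix.mul_neg, Matrix.smul_mul, Matrix.mul_smul,
        Matrix.one_mul, Matrix.mul_one]
      abel
    rw [h1, Matrix.mul_add, Matrix.add_mul, ← Matrix.mul_assoc, hX, Matrix.one_mul,
      Matrix.mul_assoc X, Matrix.mul_assoc P, hY', Matrix.mul_one, add_comm]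
  have e1 : (1 - G.C * X * flat G.C) * G.S * Vvac m * ((1 - G.C * Z * flat G.C) * G.S)ᴴ =
      (1 - G.C * X * flat G.C) * (G.S * Vvac m * G.Sᴴ) * (1 - G.C * Z * flat G.C)ᴴ := by
    simp only [Matrix.conjTranspose_mul, Matrix.mul_assoc]
  rw [e1]
  generalize G.S * Vvac m * G.Sᴴ = N at *
  simp only [Matrix.conjTranspose_sub, Matrix.conjTranspose_mul, Matrix.conjTranspose_one,
    Matrix.conjTranspose_conjTranspose, hPh, hNh]
  have e2 : (1 - G.C * X * flat G.C) * N * (1 - (flat G.C)ᴴ * (Zᴴ * G.Cᴴ)) =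
      N - G.C * X * flat G.C * N - N * ((flat G.C)ᴴ * (Zᴴ * G.Cᴴ))
        + G.C * (X * (flat G.C * N * (flat G.C)ᴴ) * Zᴴ) * G.Cᴴ := by
    simp only [Matrix.mul_sub, Matrix.sub_mul, Matrix.one_mul, Matrix.mul_one, Matrix.mul_assoc]
    abel
  rw [e2, key]
  simp only [Matrix.mul_sub, Matrix.sub_mul, Matrix.mul_add, Matrix.add_mul, Matrix.mul_assoc]
  abel

/-- The stable part of the power spectrum and its value at infinity are determined by the power
spectrum. -/
theorem SamePowerSpectrum.markov (hG₁ : G₁.IsStable) (hG₂ : G₂.IsStable)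
    {Q₁ : Matrix (Dbl n₁) (Dbl n₁) ℂ} {Q₂ : Matrix (Dbl n₂) (Dbl n₂) ℂ}
    (h₁ : G₁.IsLyapunov Q₁) (h₂ : G₂.IsLyapunov Q₂) (h : SamePowerSpectrum G₁ G₂) :
    G₁.S * Vvac m * G₁.Sᴴ = G₂.S * Vvac m * G₂.Sᴴ ∧
      ∀ j, G₁.C * G₁.A ^ j * G₁.inputMatrix Q₁ = G₂.C * G₂.A ^ j * G₂.inputMatrix Q₂ := by
  -- The difference of the two stable parts has a realization on the direct sum. Its para-adjoint
  -- has system matrix −B^†, whose spectrum lies in the right half plane, so `separation` applies.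
  set B := Matrix.fromBlocks G₁.A 0 0 G₂.A with hB
  have hBH : IsHurwitz B := isHurwitz_fromBlocks hG₁ hG₂
  have hres : ∀ s : ℂ, s ∉ spectrum ℂ G₁.A → s ∉ spectrum ℂ G₂.A →
      Matrix.fromCols G₁.C G₂.C * (s • (1 : Matrix (Dbl n₁ ⊕ Dbl n₂) (Dbl n₁ ⊕ Dbl n₂) ℂ) - B)⁻¹ *
        Matrix.fromRows (G₁.inputMatrix Q₁) (-G₂.inputMatrix Q₂) =
      G₁.C * (s • (1 : Matrix (Dbl n₁) (Dbl n₁) ℂ) - G₁.A)⁻¹ * G₁.inputMatrix Q₁ -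
        G₂.C * (s • (1 : Matrix (Dbl n₂) (Dbl n₂) ℂ) - G₂.A)⁻¹ * G₂.inputMatrix Q₂ := by
    intro s h1 h2
    have hinv := fromBlocks_resolvent h1 h2
    rw [hB, hinv, Matrix.fromCols_mul_fromBlocks, Matrix.fromCols_mul_fromRows]
    simp [sub_eq_add_neg]
  have hev : ∀ᶠ s in Bornology.cobounded ℂ,
      (G₁.S * Vvac m * G₁.Sᴴ - G₂.S * Vvac m * G₂.Sᴴ) +
      Matrix.fromCols G₁.C G₂.C * (s • (1 : Matrix (Dbl n₁ ⊕ Dbl n₂) (Dbl n₁ ⊕ Dbl n₂) ℂ) - B)⁻¹ *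
        Matrix.fromRows (G₁.inputMatrix Q₁) (-G₂.inputMatrix Q₂) +
      (-(Matrix.fromRows (G₁.inputMatrix Q₁) (-G₂.inputMatrix Q₂))ᴴ) *
        (s • (1 : Matrix (Dbl n₁ ⊕ Dbl n₂) (Dbl n₁ ⊕ Dbl n₂) ℂ) - (-Bᴴ))⁻¹ *
        (Matrix.fromCols G₁.C G₂.C)ᴴ = 0 := by
    have hfin : ∀ F : Set ℂ, F.Finite → ∀ᶠ s in Bornology.cobounded ℂ, s ∉ F :=
      fun F hF => hF.isBounded
    have hfin' : ∀ F : Set ℂ, F.Finite → ∀ᶠ s in Bornology.cobounded ℂ, -(conj s) ∉ F :=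
      fun F hF => hfin _ (hF.preimage (f := fun s => -(conj s)) fun a _ b _ hab => by
        exact (starRingEnd ℂ).injective (neg_injective hab))
    filter_upwards [hfin _ (Matrix.finite_spectrum G₁.A), hfin _ (Matrix.finite_spectrum G₂.A),
      hfin' _ (Matrix.finite_spectrum G₁.A), hfin' _ (Matrix.finite_spectrum G₂.A)]
      with s a1 a2 a3 a4
    have hs := h s a1 a2 a3 a4
    rw [powerSpectrum_eq hG₁ h₁ a1 a3, powerSpectrum_eq hG₂ h₂ a2 a4] at hs
    have hneg : (s • (1 : Matrix (Dbl n₁ ⊕ Dbl n₂) (Dbl n₁ ⊕ Dbl n₂) ℂ) - (-Bᴴ))⁻¹ =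
        -((((-(conj s)) • (1 : Matrix (Dbl n₁ ⊕ Dbl n₂) (Dbl n₁ ⊕ Dbl n₂) ℂ) - B)⁻¹)ᴴ) := by
      have hns : -(conj s) ∉ spectrum ℂ B := fun hmem =>
        (mem_spectrum_fromBlocks.1 hmem).elim a3 a4
      apply Matrix.inv_eq_right_inv
      have := congrArg Matrix.conjTranspose
        (Matrix.nonsing_inv_mul _ (isUnit_smul_one_sub hns))
      rw [Matrix.conjTranspose_mul, Matrix.conjTranspose_one] at this
      rw [Matrix.mul_neg, ← Matrix.neg_mul]
      refine Eq.trans ?_ this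
      congr 1
      simp [sub_eq_add_neg, add_comm]
    have hadj : ∀ X : Matrix (Dbl n₁ ⊕ Dbl n₂) (Dbl n₁ ⊕ Dbl n₂) ℂ,
        (Matrix.fromRows (G₁.inputMatrix Q₁) (-G₂.inputMatrix Q₂))ᴴ * Xᴴ *
          (Matrix.fromCols G₁.C G₂.C)ᴴ = (Matrix.fromCols G₁.C G₂.C * X *
          Matrix.fromRows (G₁.inputMatrix Q₁) (-G₂.inputMatrix Q₂))ᴴ := fun X => by
      rw [Matrix.conjTranspose_mul, Matrix.conjTranspose_mul, Matrix.mul_assoc]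
    rw [hres s a1 a2, hneg]
    simp only [Matrix.mul_neg, Matrix.neg_mul, neg_neg]
    rw [hadj, hres _ a3 a4, Matrix.conjTranspose_sub]
    rw [← sub_eq_zero] at hs
    rw [← hs]
    abel
  obtain ⟨h1, h2⟩ := separation hBH (by rw [neg_neg]; exact hBH.conjTranspose) hev
  refine ⟨sub_eq_zero.1 h1, fun j => ?_⟩
  have h3 := h2 j
  rw [hB, fromBlocks_diag_pow, Matrix.fromCols_mul_fromBlocks, Matrix.fromCols_mul_fromRows] at h3
  rw [← sub_eq_zero, ← h3]
  simp [sub_eq_add_neg]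

end QLS

/-! ### Symplectic Gram–Schmidt for the indefinite form. -/

section SymplecticFamily

variable {n k : ℕ}

/-- The indefinite Hermitian form `x^† J y`. -/
def form (x y : Dbl n → ℂ) : ℂ := star x ⬝ᵥ (J n *ᵥ y)

theorem J_mulVec_vbar (x : Dbl n → ℂ) : J n *ᵥ vbar x = -vbar (J n *ᵥ x) := by
  rw [← bar_mulVec_vbar, bar_J, Matrix.neg_mulVec, neg_neg]

/-- This sign lets a vector of negative norm be traded for its conjugate. -/
theorem form_vbar_vbar (x y : Dbl n → ℂ) : form (vbar x) (vbar y) = -conj (form x y) := by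
  rw [form, J_mulVec_vbar, star_vbar, dotProduct_neg, vbar_dotProduct_vbar, form]

theorem conj_form (x y : Dbl n → ℂ) : conj (form x y) = form y x := by
  rw [form, form, starRingEnd_apply, ← Matrix.star_dotProduct_star, star_star, Matrix.star_mulVec,
    conjTranspose_J, Matrix.dotProduct_mulVec, dotProduct_comm]

theorem form_vbar_left (x y : Dbl n → ℂ) : form (vbar x) y = -conj (form x (vbar y)) := by
  rw [← form_vbar_vbar, vbar_vbar]

theorem form_vbar_self (x : Dbl n → ℂ) : form x (vbar x) = 0 := by
  have h1 := form_vbar_left x x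
  rw [conj_form] at h1
  have h2 : form (vbar x) x = 0 := self_eq_neg.1 h1
  rw [← conj_form, h2, map_zero]

theorem form_smul_smul (c : ℂ) (x y : Dbl n → ℂ) :
    form (c • x) (c • y) = conj c * c * form x y := by
  simp only [form, star_smul, Matrix.mulVec_smul, smul_dotProduct, dotProduct_smul, smul_eq_mul,
    starRingEnd_apply]
  ring

theorem form_smul_right (c : ℂ) (x y : Dbl n → ℂ) : form x (c • y) = c * form x y := by
  simp only [form, Matrix.mulVec_smul, dotProduct_smul, smul_eq_mul]

/-- A non-isotropic vector or its conjugate can be normalized. -/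
theorem exists_normalize {x : Dbl n → ℂ} (hx : form x x ≠ 0) :
    ∃ c : ℂ, c ≠ 0 ∧ (form (c • x) (c • x) = 1 ∨ form (c • vbar x) (c • vbar x) = 1) := by
  obtain ⟨r, hr⟩ := Complex.conj_eq_iff_real.1 (conj_form x x)
  have hr0 : r ≠ 0 := fun h => hx (by rw [hr, h, Complex.ofReal_zero])
  have hc : ((Real.sqrt |r|)⁻¹ : ℝ) * (Real.sqrt |r|)⁻¹ * |r| = 1 := by
    have h1 := Real.mul_self_sqrt (abs_nonneg r)
    rw [← mul_inv, h1, inv_mul_cancel₀ (abs_ne_zero.2 hr0)]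
  refine ⟨((Real.sqrt |r|)⁻¹ : ℝ), ?_, ?_⟩
  · exact Complex.ofReal_ne_zero.2 (inv_ne_zero (Real.sqrt_ne_zero'.2 (abs_pos.2 hr0)))
  · rw [form_smul_smul, form_smul_smul, form_vbar_vbar, hr, Complex.conj_ofReal,
      Complex.conj_ofReal]
    rcases lt_or_gt_of_ne hr0 with h | h
    · right
      rw [abs_of_neg h] at hc ⊢
      exact_mod_cast hc
    · left
      rw [abs_of_pos h] at hc ⊢
      exact_mod_cast hc

/-- The doubled-up matrix with given columns. -/
def colMatrix (v : Fin k → Dbl n → ℂ) : Matrix (Dbl n) (Dbl k) ℂ :=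
  Matrix.of fun i j => Sum.elim v (fun j => vbar (v j)) j i

theorem bar_colMatrix (v : Fin k → Dbl n → ℂ) : bar (colMatrix v) = colMatrix v := by
  ext i (j | j) <;> simp [bar, colMatrix, vbar]

theorem conjTranspose_colMatrix_mulVec (v : Fin k → Dbl n → ℂ) (x : Dbl n → ℂ) (j : Dbl k) :
    ((colMatrix v)ᴴ *ᵥ (J n *ᵥ x)) j = form (Sum.elim v (fun j => vbar (v j)) j) x := rfl

/-- The columns of a doubled-up `♭`-isometry. -/
def IsSymplecticFamily (v : Fin k → Dbl n → ℂ) : Prop :=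
  (∀ i j, form (v i) (v j) = if i = j then 1 else 0) ∧ ∀ i j, form (v i) (vbar (v j)) = 0

theorem IsSymplecticFamily.conjTranspose_mul {v : Fin k → Dbl n → ℂ}
    (h : IsSymplecticFamily v) : (colMatrix v)ᴴ * J n * colMatrix v = J k := by
  have key : ∀ i j, ((colMatrix v)ᴴ * J n * colMatrix v) i j =
      form (Sum.elim v (fun j => vbar (v j)) i) (Sum.elim v (fun j => vbar (v j)) j) :=
    fun i j => by
      rw [Matrix.mul_assoc]; rfl
  ext (i | i) (j | j) <;> rw [key]
  · simp [h.1, J, Matrix.one_apply]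
  · simp [h.2, J]
  · simp [form_vbar_left, h.2, J]
  · simp only [Sum.elim_inr, form_vbar_vbar, h.1, J, Matrix.fromBlocks_apply₂₂, Matrix.neg_apply,
      Matrix.one_apply]
    split_ifs <;> simp

theorem IsSymplecticFamily.flat_mul {v : Fin k → Dbl n → ℂ} (h : IsSymplecticFamily v) :
    flat (colMatrix v) * colMatrix v = 1 := by
  rw [flat, Matrix.mul_assoc, Matrix.mul_assoc, ← Matrix.mul_assoc _ (J n), h.conjTranspose_mul,
    J_mul_J]

theorem colMatrix_mul_J_mul (v : Fin k → Dbl n → ℂ) :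
    colMatrix v * J k * (colMatrix v)ᴴ = ∑ j, (Matrix.vecMulVec (v j) (star (v j)) -
      Matrix.vecMulVec (vbar (v j)) (star (vbar (v j)))) := by
  have h : colMatrix v * J k = Matrix.of fun i j =>
      Sum.elim v (fun j => -vbar (v j)) j i := by
    ext i (j | j) <;> simp [colMatrix, J, Matrix.mul_apply, Matrix.one_apply]
  rw [h]
  ext i j
  simp [Matrix.mul_apply, Matrix.sum_apply, Matrix.vecMulVec_apply, colMatrix,
    sub_eq_add_neg, Finset.sum_add_distrib]

-- An eigenvector inside the range has a nonzero eigenvalue, because the kernel of a Hermitian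
-- matrix is orthogonal to its range.
open scoped ComplexOrder in
theorem exists_quadratic_ne_zero {M : Matrix (Dbl n) (Dbl n) ℂ} (hM : Mᴴ = M) (h0 : M ≠ 0) :
    ∃ x, star x ⬝ᵥ (M *ᵥ x) ≠ 0 := by
  obtain ⟨z, x, ⟨w, hw⟩, hx0, hx⟩ := exists_eigenvector_mem M.mulVecLin
    (LinearMap.range M.mulVecLin) (fun x _ => LinearMap.mem_range_self _ x) (fun h => h0 (by
      rw [LinearMap.range_eq_bot] at h
      exact Matrix.toLin'.injective (by rw [map_zero]; exact h)))
  have hx' : M *ᵥ x = z • x := hx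
  have hw' : M *ᵥ w = x := hw
  have hne : star x ⬝ᵥ x ≠ 0 := fun h => hx0 (dotProduct_star_self_eq_zero.1 h)
  refine ⟨x, fun h => ?_⟩
  rw [hx', dotProduct_smul, smul_eq_mul, mul_eq_zero, or_iff_left hne] at h
  apply hne
  conv_lhs => rw [← hw', Matrix.star_mulVec, hM, ← Matrix.dotProduct_mulVec, hw', hx', h]
  simp

/-- A symplectic family that is not complete can be extended. -/
theorem IsSymplecticFamily.exists_cons {v : Fin k → Dbl n → ℂ} (h : IsSymplecticFamily v)
    (hk : k ≠ n) : ∃ z, IsSymplecticFamily (Fin.cons z v : Fin (k + 1) → Dbl n → ℂ) := by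
  set E := colMatrix v with hE
  have hEJ := h.conjTranspose_mul
  -- With M = J − E J E^†, the matrix JM is the ♭-projection complementary to E E^♭. If M vanished,
  -- E would be symplectic, forcing k = n. Otherwise Mx is form-orthogonal to the family and has
  -- norm x^†Mx.
  have hne : J n - E * J k * Eᴴ ≠ 0 := fun h0 => hk (IsSymplectic.eq_dim (T := E) (by
    rw [isSymplectic_iff]
    refine ⟨h.flat_mul, ?_, bar_colMatrix v⟩
    rw [flat, ← Matrix.mul_assoc, ← Matrix.mul_assoc, ← sub_eq_zero.1 h0, J_mul_J])).symm
  have hMh : (J n - E * J k * Eᴴ)ᴴ = J n - E * J k * Eᴴ := by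
    rw [Matrix.conjTranspose_sub, Matrix.conjTranspose_mul, Matrix.conjTranspose_mul,
      Matrix.conjTranspose_conjTranspose, conjTranspose_J, conjTranspose_J, Matrix.mul_assoc]
  obtain ⟨x, hx⟩ := exists_quadratic_ne_zero hMh hne
  have hEM : Eᴴ * (J n * (J n - E * J k * Eᴴ)) = 0 := by
    rw [Matrix.mul_sub, Matrix.mul_sub, J_mul_J, Matrix.mul_one, ← Matrix.mul_assoc,
      ← Matrix.mul_assoc, ← Matrix.mul_assoc, hEJ, J_mul_J, Matrix.one_mul,
      sub_self]
  have hMM : (J n - E * J k * Eᴴ) * (J n * (J n - E * J k * Eᴴ)) = J n - E * J k * Eᴴ := by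
    rw [Matrix.sub_mul, J_mul_J_mul, Matrix.mul_assoc (E * J k), hEM, Matrix.mul_zero, sub_zero]
  generalize J n - E * J k * Eᴴ = M at *
  have horth : ∀ j, form (Sum.elim v (fun j => vbar (v j)) j) (M *ᵥ x) = 0 := fun j => by
    rw [← conjTranspose_colMatrix_mulVec, Matrix.mulVec_mulVec, Matrix.mulVec_mulVec, ← hE,
      Matrix.mul_assoc, hEM, Matrix.zero_mulVec]; rfl
  have hself : form (M *ᵥ x) (M *ᵥ x) ≠ 0 := by
    rw [form, Matrix.star_mulVec, hMh, ← Matrix.dotProduct_mulVec, Matrix.mulVec_mulVec,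
      Matrix.mulVec_mulVec, Matrix.mul_assoc, hMM]
    exact hx
  obtain ⟨z, hz1, hz2, hz3⟩ : ∃ z, form z z = 1 ∧ (∀ j, form (v j) z = 0) ∧
      ∀ j, form (vbar (v j)) z = 0 := by
    obtain ⟨c, _, hc | hc⟩ := exists_normalize hself
    · exact ⟨_, hc, fun j => by
        rw [form_smul_right, show form (v j) _ = 0 from horth (Sum.inl j), mul_zero],
        fun j => by
        rw [form_smul_right, show form (vbar (v j)) _ = 0 from horth (Sum.inr j), mul_zero]⟩
    · refine ⟨_, hc, fun j => ?_, fun j => ?_⟩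
      · rw [form_smul_right, ← vbar_vbar (v j), form_vbar_vbar,
          show form (vbar (v j)) _ = 0 from horth (Sum.inr j)]
        simp
      · rw [form_smul_right, form_vbar_vbar, show form (v j) _ = 0 from horth (Sum.inl j)]
        simp
  have hz2' : ∀ j, form z (v j) = 0 := fun j => by rw [← conj_form, hz2, map_zero]
  have hz3' : ∀ j, form z (vbar (v j)) = 0 := fun j => by rw [← conj_form, hz3, map_zero]
  have hz4 : ∀ j, form (v j) (vbar z) = 0 := fun j => by
    have := form_vbar_left (v j) z
    rw [hz3] at this
    simpa using this.symm
  refine ⟨z, fun i j => ?_, fun i j => ?_⟩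
  · refine Fin.cases ?_ (fun i => ?_) i <;> refine Fin.cases ?_ (fun j => ?_) j
    · simp [hz1]
    · simp [hz2', (Fin.succ_ne_zero j).symm]
    · simp [hz2]
    · simp [h.1]
  · refine Fin.cases ?_ (fun i => ?_) i <;> refine Fin.cases ?_ (fun j => ?_) j
    · simp [form_vbar_self]
    · simp [hz3']
    · simp [hz4]
    · simp [h.2]

/-- Extension happens at the front, so the prescribed vector stays in the last slot. -/
theorem exists_symplecticFamily {y : Dbl (n + 1) → ℂ} (hy : form y y = 1) :
    ∀ k ≤ n, ∃ v : Fin (k + 1) → Dbl (n + 1) → ℂ, IsSymplecticFamily v ∧ v (Fin.last k) = y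
  | 0, _ => ⟨fun _ => y, ⟨fun i j => by simp [hy, Subsingleton.elim (α := Fin 1) i j],
      fun _ _ => form_vbar_self y⟩, rfl⟩
  | k + 1, hk => by
    obtain ⟨v, hv, hvy⟩ := exists_symplecticFamily hy k (by omega)
    obtain ⟨z, hz⟩ := hv.exists_cons (by omega)
    refine ⟨_, hz, ?_⟩
    rw [← Fin.succ_last, Fin.cons_succ, hvy]

/-- The mode spanned by a normalized vector can be split off. -/
theorem exists_complement {x : Dbl (n + 1) → ℂ} (hx : form x x = 1) :
    ∃ E : Matrix (Dbl (n + 1)) (Dbl n) ℂ, bar E = E ∧ flat E * E = 1 ∧ Eᴴ *ᵥ x = 0 ∧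
      E * flat E = 1 - J (n + 1) * (Matrix.vecMulVec x (star x) -
        Matrix.vecMulVec (vbar x) (star (vbar x))) := by
  -- The family is completed from Jx rather than x: form-orthogonality to Jx is ordinary
  -- orthogonality to x, which gives E^†x = 0.
  have hy : form (J (n + 1) *ᵥ x) (J (n + 1) *ᵥ x) = 1 := by
    rw [form, Matrix.star_mulVec, conjTranspose_J, J_mulVec_J_mulVec, ← Matrix.dotProduct_mulVec]
    exact hx
  obtain ⟨v, hv, hvx⟩ := exists_symplecticFamily hy n le_rfl
  have hv' : IsSymplecticFamily fun i => v (Fin.castSucc i) :=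
    ⟨fun i j => by rw [hv.1]; simp, fun i j => hv.2 _ _⟩
  have hT : colMatrix v * J (n + 1) * (colMatrix v)ᴴ = J (n + 1) := by
    have h1 : colMatrix v * flat (colMatrix v) = 1 := mul_eq_one_comm.1 hv.flat_mul
    have := congrArg (· * J (n + 1)) h1
    simpa only [flat, ← Matrix.mul_assoc, mul_J_mul_J, Matrix.one_mul] using this
  refine ⟨colMatrix fun i => v (Fin.castSucc i), bar_colMatrix _, hv'.flat_mul, ?_, ?_⟩
  · rw [← J_mulVec_J_mulVec x, ← hvx]
    ext (j | j)
    · rw [conjTranspose_colMatrix_mulVec]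
      simp [hv.1]
    · rw [conjTranspose_colMatrix_mulVec]
      simp [form_vbar_left, hv.2]
  · have h2 := hT
    rw [colMatrix_mul_J_mul, Fin.sum_univ_castSucc, ← colMatrix_mul_J_mul, ← eq_sub_iff_add_eq]
      at h2
    rw [flat, ← Matrix.mul_assoc, ← Matrix.mul_assoc, h2, hvx, Matrix.sub_mul, J_mul_J]
    congr 1
    have e : vbar (J (n + 1) *ᵥ x) = -(J (n + 1) *ᵥ vbar x) := by rw [J_mulVec_vbar, neg_neg]
    rw [e, star_neg, Matrix.star_mulVec, Matrix.star_mulVec, conjTranspose_J, Matrix.sub_mul,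
      Matrix.mul_sub, Matrix.vecMulVec_mul, Matrix.vecMulVec_mul, Matrix.mul_vecMulVec,
      Matrix.mul_vecMulVec, Matrix.neg_vecMul, Matrix.vecMul_vecMul, Matrix.vecMul_vecMul, J_mul_J,
      Matrix.vecMul_one, Matrix.vecMul_one, Matrix.neg_vecMulVec, Matrix.vecMulVec_neg, neg_neg]

end SymplecticFamily

/-! ### Removal of an uncontrollable mode. -/

namespace QLS

variable {n m k : ℕ} {G : QLS n m}

theorem IsLyapunov.conjTranspose_inputMatrix (hG : G.IsStable) {Q : Matrix (Dbl n) (Dbl n) ℂ}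
    (h : G.IsLyapunov Q) :
    (G.inputMatrix Q)ᴴ = G.C * Q - (1 / 2 : ℂ) • (G.S * G.Sᴴ * (flat G.C)ᴴ) := by
  rw [inputMatrix, Matrix.conjTranspose_sub, Matrix.conjTranspose_mul, h.conjTranspose hG,
    Matrix.conjTranspose_smul, Matrix.conjTranspose_mul, Matrix.conjTranspose_mul,
    Matrix.conjTranspose_conjTranspose, Matrix.conjTranspose_conjTranspose]
  simp

/-- Compression to an invariant subspace that contains the input matrix and respects the
stationary state keeps the power spectrum. -/
theorem exists_reduction (hG : G.IsStable) {Q : Matrix (Dbl n) (Dbl n) ℂ} (hQ : G.IsLyapunov Q)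
    {E : Matrix (Dbl n) (Dbl k) ℂ} (hE : QuantumLinear.bar E = E) (hEE : flat E * E = 1)
    (hA : E * flat E * G.A * E = G.A * E) (hEQ : flat E * Q * (E * flat E)ᴴ = flat E * Q)
    (hK : E * flat E * G.inputMatrix Q = G.inputMatrix Q) :
    ∃ G' : QLS k m, G'.IsStable ∧ SamePowerSpectrum G' G := by
  obtain ⟨G', hS', hC', -, hA'⟩ := G.exists_compression E hE G.isSymplectic_S
  have hEA : E * G'.A = G.A * E := by
    rw [hA', ← hA]; simp only [Matrix.mul_assoc]
  have hst : G'.IsStable := by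
    intro z hz
    obtain ⟨x, hx0, hx⟩ := exists_mulVec_of_mem_spectrum hz
    refine hG z (mem_spectrum_of_mulVec (x := E *ᵥ x) (fun h => hx0 ?_) ?_)
    · rw [← Matrix.one_mulVec x, ← hEE, ← Matrix.mulVec_mulVec, h, Matrix.mulVec_zero]
    · rw [Matrix.mulVec_mulVec, ← hEA, ← Matrix.mulVec_mulVec, hx, Matrix.mulVec_smul]
  have hQE : E * flat E * (Q * (flat E)ᴴ) = Q * (flat E)ᴴ := by
    have := congrArg Matrix.conjTranspose hEQ
    simpa only [Matrix.conjTranspose_mul, Matrix.conjTranspose_conjTranspose,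
      hQ.conjTranspose hG, Matrix.mul_assoc] using this
  have hQ' : G'.IsLyapunov (flat E * Q * (flat E)ᴴ) := by
    have e1 : G'.A * (flat E * Q * (flat E)ᴴ) = flat E * (G.A * Q) * (flat E)ᴴ := by
      have : G'.A * (flat E * Q * (flat E)ᴴ) =
          flat E * G.A * (E * flat E * (Q * (flat E)ᴴ)) := by
        rw [hA']; simp only [Matrix.mul_assoc]
      rw [this, hQE]; simp only [Matrix.mul_assoc]
    have e2 : flat E * Q * (flat E)ᴴ * G'.Aᴴ = flat E * (Q * G.Aᴴ) * (flat E)ᴴ := by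
      have : flat E * Q * (flat E)ᴴ * G'.Aᴴ =
          flat E * Q * (E * flat E)ᴴ * (G.Aᴴ * (flat E)ᴴ) := by
        rw [hA']; simp only [Matrix.mul_assoc, Matrix.conjTranspose_mul]
      rw [this, hEQ]; simp only [Matrix.mul_assoc]
    have e3 := congrArg (fun X => flat E * X * (flat E)ᴴ) hQ
    simp only [Matrix.mul_zero, Matrix.zero_mul] at e3
    rw [IsLyapunov, e1, e2, ← e3, hC', hS', QuantumLinear.flat_mul]
    simp only [Matrix.mul_add, Matrix.add_mul, Matrix.mul_smul, Matrix.smul_mul,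
      Matrix.conjTranspose_mul, Matrix.mul_assoc]
  have hK' : G'.inputMatrix (flat E * Q * (flat E)ᴴ) = flat E * G.inputMatrix Q := by
    have e1 : flat E * Q * (flat E)ᴴ * (G.C * E)ᴴ = flat E * Q * (E * flat E)ᴴ * G.Cᴴ := by
      simp only [Matrix.conjTranspose_mul, Matrix.mul_assoc]
    rw [inputMatrix, hC', e1, hEQ, inputMatrix, hS', QuantumLinear.flat_mul]
    simp only [Matrix.mul_sub, Matrix.mul_smul, Matrix.mul_assoc]
  have hres : ∀ s : ℂ, s ∉ spectrum ℂ G'.A → s ∉ spectrum ℂ G.A →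
      G'.C * (s • (1 : Matrix (Dbl k) (Dbl k) ℂ) - G'.A)⁻¹ *
        G'.inputMatrix (flat E * Q * (flat E)ᴴ) =
      G.C * (s • (1 : Matrix (Dbl n) (Dbl n) ℂ) - G.A)⁻¹ * G.inputMatrix Q := by
    intro s h1 h2
    have e0 : E * (s • (1 : Matrix (Dbl k) (Dbl k) ℂ) - G'.A) =
        (s • (1 : Matrix (Dbl n) (Dbl n) ℂ) - G.A) * E := by
      rw [Matrix.mul_sub, Matrix.sub_mul, hEA]; simp
    -- E intertwines the resolvents. Since E E^♭ fixes the input matrix, the stable parts coincide.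
    have e1 : E * (s • (1 : Matrix (Dbl k) (Dbl k) ℂ) - G'.A)⁻¹ =
        (s • (1 : Matrix (Dbl n) (Dbl n) ℂ) - G.A)⁻¹ * E := by
      have u1 := Matrix.mul_nonsing_inv _ (isUnit_smul_one_sub h1)
      have u2 := Matrix.nonsing_inv_mul _ (isUnit_smul_one_sub h2)
      have u3 := congrArg (· * (E * (s • (1 : Matrix (Dbl k) (Dbl k) ℂ) - G'.A)⁻¹)) u2
      simp only [Matrix.one_mul] at u3
      rw [← u3, Matrix.mul_assoc, ← Matrix.mul_assoc _ E, ← e0, Matrix.mul_assoc E, u1,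
        Matrix.mul_one]
    rw [hK', hC', Matrix.mul_assoc G.C E, e1, Matrix.mul_assoc G.C, Matrix.mul_assoc,
      Matrix.mul_assoc, ← Matrix.mul_assoc E, hK]
  refine ⟨G', hst, fun s h1 h2 h3 h4 => ?_⟩
  rw [powerSpectrum_eq hst hQ' h1 h3, powerSpectrum_eq hG hQ h2 h4, hres _ h1 h2, hres _ h3 h4, hS']

/-- If x^†Jx = 0, then x^†Qx = 0. The Lyapunov equation then gives S^†(C^♭)^†x = 0, hence C J x = 0.
By `A_mul_J`, Jx is an eigenvector of A for −z, which stability excludes. -/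
theorem form_ne_zero_of_eigenvector (hG : G.IsStable) {Q : Matrix (Dbl n) (Dbl n) ℂ}
    (hQ : G.IsLyapunov Q) {x : Dbl n → ℂ} (hx0 : x ≠ 0) {z c : ℂ} (hx : G.Aᴴ *ᵥ x = z • x)
    (hQx : Q *ᵥ x = c • (J n *ᵥ x)) : form x x ≠ 0 := by
  intro h0
  have hq : star x ⬝ᵥ (Q *ᵥ x) = 0 := by
    rw [hQx, dotProduct_smul, show star x ⬝ᵥ (J n *ᵥ x) = 0 from h0, smul_zero]
  have h1 := congrArg (fun X => star x ⬝ᵥ (X *ᵥ x)) hQ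
  have e1 : star x ⬝ᵥ ((G.A * Q) *ᵥ x) = 0 := by
    have : star x ᵥ* G.A = conj z • star x := by
      rw [← Matrix.conjTranspose_conjTranspose G.A, ← Matrix.star_mulVec, hx, star_smul]; rfl
    rw [← Matrix.mulVec_mulVec, Matrix.dotProduct_mulVec, this, smul_dotProduct, hq, smul_zero]
  have e2 : star x ⬝ᵥ ((Q * G.Aᴴ) *ᵥ x) = 0 := by
    rw [← Matrix.mulVec_mulVec, hx, Matrix.mulVec_smul, dotProduct_smul, hq, smul_zero]
  have e3 : flat G.C * (G.S * G.Sᴴ) * (flat G.C)ᴴ =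
      (G.Sᴴ * (flat G.C)ᴴ)ᴴ * (G.Sᴴ * (flat G.C)ᴴ) := by
    simp only [Matrix.conjTranspose_mul, Matrix.conjTranspose_conjTranspose, Matrix.mul_assoc]
  simp only [Matrix.add_mulVec, dotProduct_add, e1, e2, Matrix.zero_mulVec, dotProduct_zero,
    zero_add, Matrix.smul_mulVec, dotProduct_smul, smul_eq_mul, mul_eq_zero] at h1
  have h2 := h1.resolve_left (by norm_num)
  rw [e3, ← Matrix.mulVec_mulVec, Matrix.dotProduct_mulVec, ← Matrix.star_mulVec] at h2
  have h3 : (G.Sᴴ * (flat G.C)ᴴ) *ᵥ x = 0 := by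
    open scoped ComplexOrder in exact dotProduct_star_self_eq_zero.1 h2
  have h4 : G.C *ᵥ (J n *ᵥ x) = 0 := by
    have u := G.isSymplectic_S.mul_J_mul
    have : G.C * J n = G.S * J m * (G.Sᴴ * (flat G.C)ᴴ) := by
      rw [← Matrix.mul_assoc, u, conjTranspose_flat]
      simp only [Matrix.mul_assoc, J_mul_J_mul]
    rw [Matrix.mulVec_mulVec, this, ← Matrix.mulVec_mulVec, h3, Matrix.mulVec_zero]
  have h5 := congrArg (· *ᵥ x) G.A_mul_J
  simp only [Matrix.add_mulVec, ← Matrix.mulVec_mulVec, Matrix.neg_mulVec, h4,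
    Matrix.mulVec_zero, neg_zero, hx, Matrix.mulVec_smul] at h5
  have hJ0 : J n *ᵥ x ≠ 0 := fun h => hx0 (by rw [← J_mulVec_J_mulVec x, h, Matrix.mulVec_zero])
  have h6 := hG (-z) (mem_spectrum_of_mulVec hJ0 (by
    rw [neg_smul]; exact eq_neg_of_add_eq_zero_left h5))
  have h7 := (IsHurwitz.conjTranspose hG) z (mem_spectrum_of_mulVec hx0 hx)
  simp at h6
  linarith

/-- Conjugation gives x̄ the analogous three properties, so both vectors can be split off together.
Each hypothesis of `exists_reduction` then holds because the correction in E E^♭ = 1 − J(xx^† −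
x̄x̄^†) is annihilated. -/
theorem exists_reduction_of_normalized {n : ℕ} {G : QLS (n + 1) m} (hG : G.IsStable)
    {Q : Matrix (Dbl (n + 1)) (Dbl (n + 1)) ℂ} (hQ : G.IsLyapunov Q) {x : Dbl (n + 1) → ℂ}
    (hx1 : form x x = 1) {z c : ℂ} (hx : G.Aᴴ *ᵥ x = z • x)
    (hK : (G.inputMatrix Q)ᴴ *ᵥ x = 0) (hQx : Q *ᵥ x = c • (J (n + 1) *ᵥ x)) :
    ∃ G' : QLS n m, G'.IsStable ∧ SamePowerSpectrum G' G := by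
  obtain ⟨E, hE, hEE, hEx, hc⟩ := exists_complement hx1
  have hEx' : Eᴴ *ᵥ vbar x = 0 := by
    rw [← hE, ← bar_conjTranspose, bar_mulVec_vbar, hEx, vbar_zero]
  have hx' : G.Aᴴ *ᵥ vbar x = conj z • vbar x := by
    rw [← G.bar_A, ← bar_conjTranspose, bar_mulVec_vbar, hx, vbar_smul]
  have hQx' : Q *ᵥ vbar x = (-conj c) • (J (n + 1) *ᵥ vbar x) := by
    rw [← hQ.bar hG, bar_mulVec_vbar, hQx, vbar_smul, J_mulVec_vbar, neg_smul, smul_neg, neg_neg]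
  have hK' : (G.inputMatrix Q)ᴴ *ᵥ vbar x = 0 := by
    rw [← bar_inputMatrix (hQ.bar hG), ← bar_conjTranspose, bar_mulVec_vbar, hK, vbar_zero]
  have hflat : ∀ y, Eᴴ *ᵥ y = 0 → flat E *ᵥ (J (n + 1) *ᵥ y) = 0 := fun y hy => by
    rw [Matrix.mulVec_mulVec, flat_mul_J, ← Matrix.mulVec_mulVec, hy, Matrix.mulVec_zero]
  have hstar : ∀ {p : ℕ} (M : Matrix (Dbl (n + 1)) (Dbl p) ℂ) (y : Dbl (n + 1) → ℂ),
      star y ᵥ* M = star (Mᴴ *ᵥ y) := fun M y => by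
    rw [Matrix.star_mulVec, Matrix.conjTranspose_conjTranspose]
  have hzero : ∀ {p : ℕ} (y : Dbl (n + 1) → ℂ), Matrix.vecMulVec y (0 : Dbl p → ℂ) = 0 :=
    fun y => by ext i j; simp [Matrix.vecMulVec_apply]
  have hYh : (Matrix.vecMulVec x (star x) - Matrix.vecMulVec (vbar x) (star (vbar x)))ᴴ =
      Matrix.vecMulVec x (star x) - Matrix.vecMulVec (vbar x) (star (vbar x)) := by
    simp [Matrix.conjTranspose_vecMulVec]
  refine exists_reduction hG hQ hE hEE ?_ ?_ ?_
  · rw [hc, Matrix.mul_assoc, Matrix.sub_mul, Matrix.one_mul, sub_eq_self, Matrix.mul_assoc,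
      Matrix.sub_mul, Matrix.vecMulVec_mul, Matrix.vecMulVec_mul, hstar, hstar,
      Matrix.conjTranspose_mul, ← Matrix.mulVec_mulVec, ← Matrix.mulVec_mulVec, hx, hx',
      Matrix.mulVec_smul, Matrix.mulVec_smul, hEx, hEx']
    simp [hzero]
  · rw [hc, Matrix.conjTranspose_sub, Matrix.conjTranspose_one, Matrix.mul_sub, Matrix.mul_one,
      sub_eq_self, Matrix.conjTranspose_mul, hYh, ← Matrix.mul_assoc, Matrix.mul_sub,
      Matrix.mul_vecMulVec, Matrix.mul_vecMulVec, ← Matrix.mulVec_mulVec, ← Matrix.mulVec_mulVec,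
      hQx, hQx', Matrix.mulVec_smul, Matrix.mulVec_smul, hflat _ hEx, hflat _ hEx']
    simp
  · rw [hc, Matrix.sub_mul, Matrix.one_mul, sub_eq_self, Matrix.mul_assoc, Matrix.sub_mul,
      Matrix.vecMulVec_mul, Matrix.vecMulVec_mul, hstar, hstar, hK, hK']
    simp [hzero]

/-- If the norm is negative, x̄ replaces x, with z̄ for z and −c̄ for c. -/
theorem exists_reduction_of_eigenvector (hG : G.IsStable) {Q : Matrix (Dbl n) (Dbl n) ℂ}
    (hQ : G.IsLyapunov Q) {x : Dbl n → ℂ} (hx0 : x ≠ 0) {z c : ℂ} (hx : G.Aᴴ *ᵥ x = z • x)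
    (hK : (G.inputMatrix Q)ᴴ *ᵥ x = 0) (hQx : Q *ᵥ x = c • (J n *ᵥ x)) :
    ∃ k < n, ∃ G' : QLS k m, G'.IsStable ∧ SamePowerSpectrum G' G := by
  cases n with
  | zero => exact absurd (Subsingleton.elim x 0) hx0
  | succ n =>
    refine ⟨n, n.lt_succ_self, ?_⟩
    have hx' : G.Aᴴ *ᵥ vbar x = conj z • vbar x := by
      rw [← G.bar_A, ← bar_conjTranspose, bar_mulVec_vbar, hx, vbar_smul]
    have hQx' : Q *ᵥ vbar x = (-conj c) • (J (n + 1) *ᵥ vbar x) := by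
      rw [← hQ.bar hG, bar_mulVec_vbar, hQx, vbar_smul, J_mulVec_vbar, neg_smul, smul_neg, neg_neg]
    have hK' : (G.inputMatrix Q)ᴴ *ᵥ vbar x = 0 := by
      rw [← bar_inputMatrix (hQ.bar hG), ← bar_conjTranspose, bar_mulVec_vbar, hK, vbar_zero]
    obtain ⟨a, -, ha | ha⟩ :=
      exists_normalize (form_ne_zero_of_eigenvector hG hQ hx0 hx hQx)
    · exact exists_reduction_of_normalized hG hQ ha (z := z) (c := c)
        (by rw [Matrix.mulVec_smul, hx, smul_comm])
        (by rw [Matrix.mulVec_smul, hK, smul_zero])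
        (by rw [Matrix.mulVec_smul, hQx, Matrix.mulVec_smul, smul_comm])
    · exact exists_reduction_of_normalized hG hQ ha (z := conj z) (c := -conj c)
        (by rw [Matrix.mulVec_smul, hx', smul_comm])
        (by rw [Matrix.mulVec_smul, hK', smul_zero])
        (by rw [Matrix.mulVec_smul, hQx', Matrix.mulVec_smul, smul_comm])

/-- An uncontrollable mode of the stable part of the power spectrum can be removed. -/
theorem exists_smaller (hG : G.IsStable) {Q : Matrix (Dbl n) (Dbl n) ℂ} (hQ : G.IsLyapunov Q)
    {x : Dbl n → ℂ} (hx0 : x ≠ 0) {z : ℂ} (hx : G.Aᴴ *ᵥ x = z • x)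
    (hK : (G.inputMatrix Q)ᴴ *ᵥ x = 0) :
    ∃ k < n, ∃ G' : QLS k m, G'.IsStable ∧ SamePowerSpectrum G' G := by
  have hKx : (1 / 2 : ℂ) • ((G.S * G.Sᴴ * (flat G.C)ᴴ) *ᵥ x) = G.C *ᵥ (Q *ᵥ x) := by
    rw [hQ.conjTranspose_inputMatrix hG, Matrix.sub_mulVec, sub_eq_zero, Matrix.smul_mulVec,
      ← Matrix.mulVec_mulVec x G.C] at hK
    exact hK.symm
  have hlyap : ∀ y, G.A *ᵥ (Q *ᵥ y) + Q *ᵥ (G.Aᴴ *ᵥ y) +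
      flat G.C *ᵥ ((1 / 2 : ℂ) • ((G.S * G.Sᴴ * (flat G.C)ᴴ) *ᵥ y)) = 0 := fun y => by
    have := congrArg (· *ᵥ y) hQ
    simpa only [Matrix.add_mulVec, Matrix.smul_mulVec, Matrix.mulVec_smul, Matrix.mulVec_mulVec,
      Matrix.zero_mulVec, Matrix.mul_assoc] using this
  set r := J n *ᵥ (Q *ᵥ x) with hr
  have hAr : G.Aᴴ *ᵥ r = z • r := by
    have h1 := hlyap x
    rw [hKx, hx, Matrix.mulVec_smul] at h1
    have h2 : flat G.A *ᵥ (Q *ᵥ x) = z • (Q *ᵥ x) := by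
      rw [flat_A_eq, Matrix.sub_mulVec, Matrix.neg_mulVec, ← Matrix.mulVec_mulVec _ (flat G.C)]
      rw [← sub_eq_zero, ← neg_eq_zero, ← h1]
      abel
    rw [hr, Matrix.mulVec_mulVec, ← J_mul_flat, ← Matrix.mulVec_mulVec, h2, Matrix.mulVec_smul]
  -- K^†x = 0 is used a second time, together with S S^† J S S^† = J. The 1/4 is the product of the
  -- two halves.
  have hMr : (1 / 2 : ℂ) • ((G.S * G.Sᴴ * (flat G.C)ᴴ) *ᵥ r) =
      (1 / 4 : ℂ) • (G.C *ᵥ (J n *ᵥ x)) := by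
    have u1 := G.isSymplectic_S.mul_J_mul
    have u2 := G.isSymplectic_S.conjTranspose_mul_J_mul
    have e1 : (flat G.C)ᴴ *ᵥ r = J m *ᵥ (G.C *ᵥ (Q *ᵥ x)) := by
      rw [hr, conjTranspose_flat]
      simp only [Matrix.mulVec_mulVec, Matrix.mul_assoc, J_mul_J_mul]
    have e2 : G.S * G.Sᴴ * J m * (G.S * G.Sᴴ * (flat G.C)ᴴ) = G.C * J n := by
      calc G.S * G.Sᴴ * J m * (G.S * G.Sᴴ * (flat G.C)ᴴ)
          = G.S * (G.Sᴴ * J m * G.S) * G.Sᴴ * (flat G.C)ᴴ := by simp only [Matrix.mul_assoc]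
        _ = G.C * J n := by
          rw [u2, u1, conjTranspose_flat]; simp only [Matrix.mul_assoc, J_mul_J_mul]
    rw [← Matrix.mulVec_mulVec, e1, ← hKx, Matrix.mulVec_smul, Matrix.mulVec_smul,
      Matrix.mulVec_mulVec, Matrix.mulVec_mulVec, e2, smul_smul, Matrix.mulVec_mulVec]
    norm_num
  -- The Lyapunov equation at r and a quarter of `A_mul_J` at x have the same source. A nonzero
  -- difference of their solutions would be an eigenvector of A for −z.
  have hQr : Q *ᵥ r = (1 / 4 : ℂ) • (J n *ᵥ x) := by
    have h1 := hlyap r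
    rw [hMr, hAr, Matrix.mulVec_smul, Matrix.mulVec_smul] at h1
    have h2 := congrArg (· *ᵥ x) G.A_mul_J
    simp only [Matrix.add_mulVec, ← Matrix.mulVec_mulVec, Matrix.neg_mulVec, hx,
      Matrix.mulVec_smul] at h2
    by_contra hne
    have h3 : G.A *ᵥ (Q *ᵥ r - (1 / 4 : ℂ) • (J n *ᵥ x)) =
        (-z) • (Q *ᵥ r - (1 / 4 : ℂ) • (J n *ᵥ x)) := by
      rw [Matrix.mulVec_sub, Matrix.mulVec_smul, eq_neg_of_add_eq_zero_left
        ((add_assoc _ _ _).symm.trans h1), eq_sub_of_add_eq h2]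
      module
    have h4 := hG (-z) (mem_spectrum_of_mulVec (sub_ne_zero.2 hne) h3)
    have h5 := (IsHurwitz.conjTranspose hG) z (mem_spectrum_of_mulVec hx0 hx)
    simp at h4
    linarith
  have hKr : (G.inputMatrix Q)ᴴ *ᵥ r = 0 := by
    rw [hQ.conjTranspose_inputMatrix hG, Matrix.sub_mulVec, Matrix.smul_mulVec, hMr,
      ← Matrix.mulVec_mulVec r G.C, hQr, Matrix.mulVec_smul, sub_self]
  have hJr : Q *ᵥ x = J n *ᵥ r := by rw [hr, J_mulVec_J_mulVec]
  -- JQ sends x to r and r to x/4, so r + x/2 has eigenvalue 1/2 unless it vanishes, in which case x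
  -- has eigenvalue −1/2.
  by_cases hp : r + (1 / 2 : ℂ) • x = 0
  · refine exists_reduction_of_eigenvector hG hQ (x := x) hx0 hx hK (c := -(1 / 2)) ?_
    rw [hJr, eq_neg_of_add_eq_zero_left hp, Matrix.mulVec_neg, Matrix.mulVec_smul, neg_smul]
  · refine exists_reduction_of_eigenvector hG hQ (x := r + (1 / 2 : ℂ) • x) hp (z := z)
      (c := 1 / 2) ?_ ?_ ?_
    · rw [Matrix.mulVec_add, Matrix.mulVec_smul, hAr, hx]; module
    · rw [Matrix.mulVec_add, Matrix.mulVec_smul, hKr, hK]; simp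
    · rw [Matrix.mulVec_add, Matrix.mulVec_smul, hQr, hJr, Matrix.mulVec_add, Matrix.mulVec_smul]
      module

/-- Globally minimal systems have a controllable stable part of the power spectrum. -/
theorem controllable (hG : G.IsStable) (hmin : G.IsGloballyMinimal)
    {Q : Matrix (Dbl n) (Dbl n) ℂ} (hQ : G.IsLyapunov Q) (y : Dbl n → ℂ)
    (hy : ∀ j, y ᵥ* (G.A ^ j * G.inputMatrix Q) = 0) : y = 0 := by
  by_contra hne
  let p : Submodule ℂ (Dbl n → ℂ) :=
    ⨅ j, LinearMap.ker ((G.A ^ j * G.inputMatrix Q)ᴴ).mulVecLin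
  have hmem : ∀ y, y ∈ p ↔ ∀ j, (G.A ^ j * G.inputMatrix Q)ᴴ *ᵥ y = 0 := fun y => by
    simp [p, Submodule.mem_iInf]
  obtain ⟨z, x, hx, hx0, hxz⟩ := exists_eigenvector_mem G.Aᴴ.mulVecLin p
    (fun x hx => (hmem _).2 fun j => by
      have := (hmem x).1 hx (j + 1)
      rwa [pow_succ', Matrix.mul_assoc, Matrix.conjTranspose_mul, ← Matrix.mulVec_mulVec] at this)
    (fun hbot => hne (star_eq_zero.1 ((Submodule.eq_bot_iff p).1 hbot (star y)
      ((hmem _).2 fun j => by rw [← Matrix.star_vecMul, hy, star_zero]))))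
  obtain ⟨k, hk, G', hG', hps⟩ := exists_smaller hG hQ hx0 hxz (by simpa using (hmem x).1 hx 0)
  exact hmin k hk G' hG' hps

end QLS

/-! ### Symplectic equivalence of globally minimal systems. -/

namespace QLS

variable {n n₁ n₂ m : ℕ} {G : QLS n m} {G₁ : QLS n₁ m} {G₂ : QLS n₂ m}

theorem IsStable.isHurwitz_flat (hG : G.IsStable) : IsHurwitz (flat G.A) := by
  intro z hz
  obtain ⟨x, hx0, hx⟩ := exists_mulVec_of_mem_spectrum hz
  refine (IsHurwitz.conjTranspose hG) z (mem_spectrum_of_mulVec (x := J n *ᵥ x) (fun h => hx0 ?_) ?_)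
  · rw [← J_mulVec_J_mulVec x, h, Matrix.mulVec_zero]
  · rw [Matrix.mulVec_mulVec, ← J_mul_flat, ← Matrix.mulVec_mulVec, hx, Matrix.mulVec_smul]

/-- A similarity between stable systems is symplectic. -/
theorem isSymplectic_of_similarity (hG₁ : G₁.IsStable) (hG₂ : G₂.IsStable)
    {T : Matrix (Dbl n₁) (Dbl n₂) ℂ} {T' : Matrix (Dbl n₂) (Dbl n₁) ℂ} (hT : T * T' = 1)
    (hC : G₁.C * T = G₂.C) (hA : G₁.A * T = T * G₂.A) : IsSymplectic T ∧ T' = flat T := by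
  have hpow : ∀ X : Matrix (Dbl n₁) (Dbl n₂) ℂ, G₁.C * X = G₂.C → G₁.A * X = X * G₂.A →
      ∀ j, G₁.C * G₁.A ^ j * X = G₂.C * G₂.A ^ j := by
    intro X hX hX' j
    have : G₁.A ^ j * X = X * G₂.A ^ j := by
      induction j with
      | zero => simp
      | succ j ih => rw [pow_succ, Matrix.mul_assoc, hX', ← Matrix.mul_assoc, ih, Matrix.mul_assoc,
          ← pow_succ]
    rw [Matrix.mul_assoc, this, ← Matrix.mul_assoc, hX]
  -- The conjugate of T satisfies the same intertwining relations, as all system matrices are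
  -- doubled-up.
  have hbar : bar T = T := eq_of_observable (G₁.observable hG₁) fun j => by
    rw [hpow T hC hA, hpow (bar T)]
    · rw [← G₁.bar_C, ← bar_mul, hC, bar_C]
    · rw [← G₁.bar_A, ← bar_mul, hA, bar_mul, bar_A]
  -- Both T^♭T and 1 solve A₂^♭X + XA₂ = −C₂^♭C₂, whose solution is unique.
  have h1 : flat T * T = 1 := by
    rw [← sub_eq_zero]
    refine eq_zero_of_sylvester hG₂.isHurwitz_flat hG₂ ?_
    have e1 : flat G₂.A * (flat T * T) = -(flat T * T * G₂.A) - flat G₂.C * G₂.C := by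
      calc flat G₂.A * (flat T * T) = flat (T * G₂.A) * T := by
            rw [flat_mul, Matrix.mul_assoc]
        _ = flat T * flat G₁.A * T := by rw [← hA, flat_mul]
        _ = -(flat T * (G₁.A * T)) - flat (G₁.C * T) * (G₁.C * T) := by
            rw [flat_A_eq, flat_mul]
            simp only [Matrix.mul_sub, Matrix.sub_mul, Matrix.mul_neg, Matrix.neg_mul,
              Matrix.mul_assoc]
        _ = _ := by rw [hA, hC, Matrix.mul_assoc]
    rw [Matrix.mul_sub, Matrix.sub_mul, e1, Matrix.mul_one, Matrix.one_mul, flat_A_eq]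
    abel
  have h2 : T' = flat T := by
    rw [← Matrix.mul_one (flat T), ← hT, ← Matrix.mul_assoc, h1, Matrix.one_mul]
  exact ⟨(isSymplectic_iff T).2 ⟨h1, h2 ▸ hT, hbar⟩, h2⟩

/-- Globally minimal systems with the same power spectrum are symplectically equivalent. -/
theorem SamePowerSpectrum.exists_symplectic (hG₁ : G₁.IsStable) (hG₂ : G₂.IsStable)
    (hmin₁ : G₁.IsGloballyMinimal) (hmin₂ : G₂.IsGloballyMinimal)
    (h : SamePowerSpectrum G₁ G₂) :
    G₁.S * Vvac m * G₁.Sᴴ = G₂.S * Vvac m * G₂.Sᴴ ∧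
      ∃ T : Matrix (Dbl n₁) (Dbl n₂) ℂ, IsSymplectic T ∧ G₁.C = G₂.C * flat T ∧
        G₁.A = T * G₂.A * flat T := by
  obtain ⟨Q₁, hQ₁⟩ := exists_isLyapunov hG₁
  obtain ⟨Q₂, hQ₂⟩ := exists_isLyapunov hG₂
  obtain ⟨hS, hmarkov⟩ := h.markov hG₁ hG₂ hQ₁ hQ₂
  obtain ⟨T, T', hTT', hT'T, hC, hA⟩ := exists_similarity hmarkov (G₁.observable hG₁)
    (G₂.observable hG₂) (controllable hG₁ hmin₁ hQ₁) (controllable hG₂ hmin₂ hQ₂)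
  obtain ⟨hT, rfl⟩ := isSymplectic_of_similarity hG₁ hG₂ hTT' hC hA
  refine ⟨hS, T, hT, ?_, ?_⟩
  · rw [← hC, Matrix.mul_assoc, hTT', Matrix.mul_one]
  · rw [← hA, Matrix.mul_assoc, hTT', Matrix.mul_one]

theorem spectrum_conj_symplectic {T : Matrix (Dbl n) (Dbl n) ℂ} (hT : IsSymplectic T)
    (A : Matrix (Dbl n) (Dbl n) ℂ) : spectrum ℂ (T * A * flat T) = spectrum ℂ A :=
  spectrum.units_conjugate (u := ⟨T, flat T, hT.2.1, hT.1⟩)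

/-- Equality of power spectra is required only off the poles, so chaining two equalities could lose
the eigenvalues of the middle system. Equal spectra prevent this. -/
theorem IsGloballyMinimal.of_samePowerSpectrum {G' : QLS n m} (hmin : G.IsGloballyMinimal)
    (hspec : spectrum ℂ G'.A = spectrum ℂ G.A) (h : SamePowerSpectrum G' G) :
    G'.IsGloballyMinimal := fun k hk H hH hsame => hmin k hk H hH fun s h1 h2 h3 h4 => by
  rw [← hspec] at h2 h4
  rw [hsame s h1 h2 h3 h4, h s h2 (hspec ▸ h2) h4 (hspec ▸ h4)]

/-- Symplectic and passive transformations of a system. -/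
theorem exists_transformed (hG : G.IsStable) (hmin : G.IsGloballyMinimal) (hS : G.S = 1)
    {T : Matrix (Dbl n) (Dbl n) ℂ} {U : Matrix (Dbl m) (Dbl m) ℂ} (hT : IsSymplectic T)
    (hU : IsPassive U) :
    ∃ G' : QLS n m, G'.S = U ∧ G'.C = G.C * flat T ∧ G'.A = T * G.A * flat T ∧
      G'.IsStable ∧ G'.IsGloballyMinimal ∧ SamePowerSpectrum G G' ∧ TransferEqMul G' G U := by
  obtain ⟨G', hS', hC', -, hA'⟩ :=
    G.exists_compression (flat T) ((isSymplectic_iff _).1 hT.flat).2.2 hU.1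
  rw [flat_flat] at hA'
  have hspec : spectrum ℂ G'.A = spectrum ℂ G.A := by rw [hA', spectrum_conj_symplectic hT]
  have htr : TransferEqMul G' G U :=
    transferEqMul_of_symplectic hT hC' hA' (by rw [hS', hS, Matrix.one_mul])
  have hps := htr.samePowerSpectrum hU
  exact ⟨G', hS', hC', hA', fun z hz => hG z (hspec ▸ hz), hmin.of_samePowerSpectrum hspec hps,
    hps.symm, htr⟩

end QLS

end QuantumLinear

/-! ### The three characterizations. -/

theorem mainTheorem4 {m n₁ n₂ : ℕ} (G₁ : QLS n₁ m) (G₂ : QLS n₂ m)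
    (hstable₁ : G₁.IsStable) (hstable₂ : G₂.IsStable)
    (hmin₁ : G₁.IsGloballyMinimal) (hmin₂ : G₂.IsGloballyMinimal) :
    (QLS.SamePowerSpectrum G₁ G₂ ↔
      G₁.S * Vvac m * G₁.Sᴴ = G₂.S * Vvac m * G₂.Sᴴ ∧ n₁ = n₂ ∧
        ∃ T : Matrix (Dbl n₁) (Dbl n₂) ℂ, IsSymplectic T ∧
          G₁.C = G₂.C * flat T ∧
          J n₁ * G₁.Omega = T * (J n₂ * G₂.Omega) * flat T) ∧
    (QLS.SamePowerSpectrum G₁ G₂ ↔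
      ∃ U : Matrix (Dbl m) (Dbl m) ℂ, IsPassive U ∧ QLS.TransferEqMul G₁ G₂ U) ∧
    (G₁.S = 1 →
      (QLS.SamePowerSpectrum G₁ G₂ ↔
        ∃ (T : Matrix (Dbl n₂) (Dbl n₁) ℂ) (U : Matrix (Dbl m) (Dbl m) ℂ),
          IsSymplectic T ∧ IsPassive U ∧
          G₂.S = U ∧ G₂.C = G₁.C * flat T ∧ G₂.A = T * G₁.A * flat T) ∧
      ∀ (T : Matrix (Dbl n₁) (Dbl n₁) ℂ) (U : Matrix (Dbl m) (Dbl m) ℂ),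
        IsSymplectic T → IsPassive U →
        ∃ G' : QLS n₁ m,
          G'.S = U ∧ G'.C = G₁.C * flat T ∧ G'.A = T * G₁.A * flat T ∧
          G'.IsStable ∧ G'.IsGloballyMinimal ∧
          QLS.SamePowerSpectrum G₁ G' ∧ QLS.TransferEqMul G' G₁ U) := by
  refine ⟨⟨fun h => ?_, ?_⟩, ⟨fun h => ?_, ?_⟩, fun hS => ⟨⟨fun h => ?_, ?_⟩, ?_⟩⟩
  · obtain ⟨hV, T, hT, hC, hA⟩ := h.exists_symplectic hstable₁ hstable₂ hmin₁ hmin₂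
    exact ⟨hV, hT.eq_dim, T, hT, hC, (QLS.A_eq_iff hC).2 hA⟩
  · rintro ⟨hV, -, T, hT, hC, hO⟩
    obtain ⟨U, hU, hSU⟩ := exists_passive G₁.isSymplectic_S G₂.isSymplectic_S hV
    exact (QLS.transferEqMul_of_symplectic hT hC ((QLS.A_eq_iff hC).1 hO) hSU).samePowerSpectrum hU
  · obtain ⟨hV, T, hT, hC, hA⟩ := h.exists_symplectic hstable₁ hstable₂ hmin₁ hmin₂
    obtain ⟨U, hU, hSU⟩ := exists_passive G₁.isSymplectic_S G₂.isSymplectic_S hV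
    exact ⟨U, hU, QLS.transferEqMul_of_symplectic hT hC hA hSU⟩
  · rintro ⟨U, hU, h⟩
    exact h.samePowerSpectrum hU
  -- The systems are exchanged because here the second one is expressed through the first.
  · obtain ⟨hV, T, hT, hC, hA⟩ := h.symm.exists_symplectic hstable₂ hstable₁ hmin₂ hmin₁
    obtain ⟨U, hU, hSU⟩ := exists_passive G₂.isSymplectic_S G₁.isSymplectic_S hV
    exact ⟨T, U, hT, hU, by rw [hSU, hS, Matrix.one_mul], hC, hA⟩
  · rintro ⟨T, U, hT, hU, hSU, hC, hA⟩
    exact ((QLS.transferEqMul_of_symplectic hT hC hA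
      (by rw [hS, hSU, Matrix.one_mul])).samePowerSpectrum hU).symm
  · exact fun T U hT hU => QLS.exists_transformed hstable₁ hmin₁ hS hT hU
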